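/- For an integer $k\ge 2$ and $p,q,s\in[0,1]$, let $\mathsf{SignedBlock}_k(p,q,s)$ be the law of the random symmetric matrix $A\in\mathbb{R}^{2k\times 2k}$ with zero diagonal and $a_{ij}=a_{ji}=P_{ij}(1-2S_{ij})$ for $i<j$, where all $P_{ij},S_{ij}$ ($1\le i<j\le 2k$) are mutually independent Bernoulli variables such that: if $i,j$ belong to the same one of the two communities $\{1,\dots,k\}$ and $\{k+1,\dots,2k\}$, then $P_{ij}$ has parameter $p$ and $S_{ij}$ has parameter $s$; otherwise $P_{ij}$ has parameter $q$ and $S_{ij}$ has parameter $1-s$. (Thus $A$ is the signed adjacency matrix of a two-community signed stochastic block model.) Write $\lambda_1(A)\le\dots\le\lambda_{2k}(A)$ for the eigenvalues of $A$, counted with multiplicity. Let $\gamma_1>\gamma_2>0$ and $0<s<1/2$. Then there exist a constant $C>0$ and a sequence $\varepsilon_k\to 0$, both depending only on $\gamma_1,\gamma_2,s$, such that for every integer $k\ge 2$ with $\gamma_1\log k/k\le 1$, if $A\sim\mathsf{SignedBlock}_k(\gamma_1\log k/k,\ \gamma_2\log k/k,\ s)$, then with probability at least $1-k^{-2}$ all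 of the following hold simultaneously: $$|\lambda_{2k}(A)-(1-2s)(\gamma_1+\gamma_2)\log k|\le C\sqrt{\log k}+\varepsilon_k,$$ $$|\lambda_{2k-1}(A)-(1-2s)(\gamma_1-\gamma_2)\log k|\le C\sqrt{\log k}+\varepsilon_k,$$ $$|\lambda_\ell(A)|\le C\sqrt{\log k}+\varepsilon_k\qquad\text{for all } 1\le\ell<2k-1.$$ -/

import Mathlib

open MeasureTheory ProbabilityTheory Filter Topology unitInterval

noncomputable section

namespace SignedSBM

/-- The `ℓ`-th smallest eigenvalue `λ_ℓ(A)`, `1 ≤ ℓ ≤ n`, of a real symmetric `n × n` matrix,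
so that `λ_1(A) ≤ ... ≤ λ_n(A)`, with multiplicity (Mathlib's `eigenvalues₀` is the decreasing
list of all eigenvalues, indexed from `0`). The value is `0` for indices outside `1, ..., n`,
which are never used. -/
def ascEigenvalue {n : ℕ} {A : Matrix (Fin n) (Fin n) ℝ} (hA : A.IsHermitian) (ℓ : ℕ) : ℝ :=
  if h : 1 ≤ ℓ ∧ ℓ ≤ n then
    hA.eigenvalues₀ ⟨n - ℓ, by rw [Fintype.card_fin]; omega⟩
  else 0

/-- The pairs `{i, j}` of distinct nodes, each represented once, with `i < j`. -/
abbrev Pairs (n : ℕ) : Type := {e : Fin n × Fin n // e.1 < e.2}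

/-- An outcome of the sampling: for each pair `e`, the first Boolean tells whether `e` is an
edge, the second one whether the sign attached to `e` is negative. -/
abbrev Outcome (n : ℕ) : Type := Pairs n → Bool × Bool

/-- The product measure on outcomes: independently over all pairs `{i, j}`, and independently
of each other, the edge indicator is Bernoulli with parameter `P i j` and the negative-sign
indicator is Bernoulli with parameter `S i j`. -/
def outcomeMeasure {n : ℕ} (P S : Matrix (Fin n) (Fin n) I) : Measure (Outcome n) :=
  Measure.pi fun e : Pairs n =>
    (bernoulliMeasure true false (P e.1.1 e.1.2)).prod
      (bernoulliMeasure true false (S e.1.1 e.1.2))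

/-- The matrix entry produced by one pair: `1` for a positive edge, `-1` for a negative edge and
`0` for a non-edge. -/
def signedEntry (b : Bool × Bool) : ℝ :=
  if b.1 then (if b.2 then -1 else 1) else 0

/-- The signed adjacency matrix of an outcome: symmetric, with zero diagonal. -/
def signedAdjacency {n : ℕ} (ω : Outcome n) : Matrix (Fin n) (Fin n) ℝ :=
  Matrix.of fun i j =>
    if h : i < j then signedEntry (ω ⟨(i, j), h⟩)
    else if h : j < i then signedEntry (ω ⟨(j, i), h⟩)
    else 0

/-- Matrices carry the product (Borel) σ-algebra of their entries. -/
instance matrixMeasurableSpace (n : ℕ) : MeasurableSpace (Matrix (Fin n) (Fin n) ℝ) :=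
  inferInstanceAs (MeasurableSpace (Fin n → Fin n → ℝ))

/-- The signed inhomogeneous Erdős–Rényi model: the law of the random signed
adjacency matrix with edge probabilities `P` and negative-sign probabilities `S` (symmetric
matrices). -/
def signedErdosRenyi {n : ℕ} (P S : Matrix (Fin n) (Fin n) I) :
    Measure (Matrix (Fin n) (Fin n) ℝ) :=
  (outcomeMeasure P S).map signedAdjacency

/-- The matrix indexed by the nodes `0, ..., 2k - 1`, split into the communities
`0, ..., k - 1` and `k, ..., 2k - 1`, with entry `a` for distinct nodes of the same community,
`b` for nodes of different communities, and `0` on the diagonal. -/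
def blockMatrix (k : ℕ) (a b : I) : Matrix (Fin (2 * k)) (Fin (2 * k)) I :=
  Matrix.of fun i j =>
    if i = j then 0 else if ((i : ℕ) < k ↔ (j : ℕ) < k) then a else b

/-- The signed stochastic bisection model `SignedBlock_k(p, q, s)`, as a law on signed adjacency
matrices: within a community edges have probability `p` and negative signs probability `s`;
across the communities edges have probability `q` and negative signs probability `1 - s`. -/
def signedBlock (k : ℕ) (p q s : I) : Measure (Matrix (Fin (2 * k)) (Fin (2 * k)) ℝ) :=
  signedErdosRenyi (blockMatrix k p q) (blockMatrix k s (unitInterval.symm s))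

instance isProbabilityMeasure_outcomeMeasure {n : ℕ} (P S : Matrix (Fin n) (Fin n) I) :
    IsProbabilityMeasure (outcomeMeasure P S) := by
  unfold outcomeMeasure; infer_instance

theorem measurable_signedAdjacency {n : ℕ} :
    Measurable (signedAdjacency : Outcome n → Matrix (Fin n) (Fin n) ℝ) :=
  measurable_of_finite _

instance isProbabilityMeasure_signedBlock (k : ℕ) (p q s : I) :
    IsProbabilityMeasure (signedBlock k p q s) :=
  Measure.isProbabilityMeasure_map measurable_signedAdjacency.aemeasurable

end SignedSBM

end

/-! Off the diagonal, the mean of `A` is a combination of the projections onto the community vector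
and the constant vector, with eigenvalues `(1-2s)(p+q)k` and `(1-2s)(p-q)k`. The zero diagonal only
subtracts `(1-2s)p` times the identity, and this is absorbed by `ε`. By the min-max principle
(`eigenvalues_rank_two_perturbation`), it is enough to show that the centred matrix has norm `O(√log
k)` with high probability.

The norm is controlled by the trace of the power `2m` with `m ≈ log k`. By independence and
centring, only closed walks that use every edge at least twice contribute, each at most `p ^ e` with
`e` its number of distinct edges. Such walks are grouped by pattern: a pattern with `v ≤ e + 1`
vertices occurs `n(n-1)...(n-v+1)` times, and its weighted count is at most `n / r` times its count
on `r` vertices once `r ≥ np + 2m` (`sum_goodWalks_le`). The latter counts are bounded by a trace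
moment of a dense `r × r` matrix with bounded independent centred entries whose higher moments are
all at least `1`. Here `r` may be taken of order `log k`, so a crude net argument, costing `25 ^ r`,
loses only a factor `const ^ m` (`integral_trace_pow_refMatrix_le`). Markov's inequality then gives
the probability (`measureReal_trace_pow_noise_le`). -/

namespace SignedSBM

/-! ### Counting closed walks -/

section Walks

variable {V W : Type*} {N : ℕ}

/-- The edge traversed by the walk `w` in its step `i`. -/
def walkStep (w : Fin (N + 1) → V) (i : Fin N) : Sym2 V := s(w i.castSucc, w i.succ)

/-- Every value of `c` is attained at least twice. -/
def Repeated {E : Type*} (c : Fin N → E) : Prop := ∀ i, ∃ j, j ≠ i ∧ c j = c i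

/-- Two functions with the same domain and the same fibres. -/
def SameKer {α : Type*} (f : α → V) (g : α → W) : Prop := ∀ i j, f i = f j ↔ g i = g j

theorem SameKer.symm {α : Type*} {f : α → V} {g : α → W} (h : SameKer f g) : SameKer g f :=
  fun i j => (h i j).symm

theorem SameKer.card_image_le {α : Type*} [Fintype α] [DecidableEq V] [DecidableEq W]
    {f : α → V} {g : α → W} (h : SameKer f g) :
    (Finset.univ.image f).card ≤ (Finset.univ.image g).card := by
  classical
  rcases isEmpty_or_nonempty α with hα | hα
  · simp
  refine Finset.card_le_card_of_surjOn (fun x => f (Function.invFun g x)) ?_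
  intro y hy
  simp only [Finset.coe_image, Finset.coe_univ, Set.image_univ, Set.mem_range] at hy
  obtain ⟨a, rfl⟩ := hy
  refine ⟨g a, by simp, ?_⟩
  exact (h _ _).2 (Function.invFun_eq (f := g) ⟨a, rfl⟩)

theorem SameKer.card_image_eq {α : Type*} [Fintype α] [DecidableEq V] [DecidableEq W]
    {f : α → V} {g : α → W} (h : SameKer f g) :
    (Finset.univ.image f).card = (Finset.univ.image g).card :=
  le_antisymm h.card_image_le h.symm.card_image_le

theorem SameKer.walkStep {w : Fin (N + 1) → V} {u : Fin (N + 1) → W} (h : SameKer w u) :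
    SameKer (walkStep w) (walkStep u) := by
  intro i j
  simp only [SignedSBM.walkStep, Sym2.eq_iff, h _ _]

theorem SameKer.repeated {E F : Type*} {c : Fin N → E} {d : Fin N → F} (h : SameKer c d)
    (hc : Repeated c) : Repeated d := fun i => by
  obtain ⟨j, hj, hji⟩ := hc i
  exact ⟨j, hj, (h _ _).1 hji⟩

/-- A function with the fibres of `f` is the same thing as an injection of the image of `f` into
`W`. -/
theorem card_sameKer {α : Type*} [Fintype α] [DecidableEq α] [Fintype W] [DecidableEq V]
    [DecidableEq W]
    (f : α → V) [DecidablePred fun u : α → W => SameKer f u] :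
    (Finset.univ.filter fun u : α → W => SameKer f u).card =
      (Fintype.card W).descFactorial (Finset.univ.image f).card := by
  classical
  have e : {u : α → W // SameKer f u} ≃ (↥(Finset.univ.image f) ↪ W) :=
    { toFun := fun u =>
        ⟨fun x => u.1 (Finset.mem_image.1 x.2).choose, fun x y hxy => by
          have hx := (Finset.mem_image.1 x.2).choose_spec.2
          have hy := (Finset.mem_image.1 y.2).choose_spec.2
          apply Subtype.ext
          rw [← hx, ← hy]
          exact (u.2 _ _).2 hxy⟩
      invFun := fun g => ⟨fun a => g ⟨f a, Finset.mem_image_of_mem _ (Finset.mem_univ a)⟩,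
        fun i j => by simp⟩
      left_inv := fun u => by
        apply Subtype.ext
        funext a
        exact (u.2 _ _).1
          (Finset.mem_image.1 (Finset.mem_image_of_mem f (Finset.mem_univ a))).choose_spec.2
      right_inv := fun g => by
        ext x
        have hx := (Finset.mem_image.1 x.2).choose_spec.2
        exact congrArg g (Subtype.ext hx) }
  rw [← Fintype.card_subtype, Fintype.card_congr e, Fintype.card_embedding_eq, Fintype.card_coe]

/-- Each step that reaches a new vertex does so along a new edge, and the starting vertex accounts
for the extra `1`. -/
theorem card_image_range_le (w : ℕ → V) [DecidableEq V] (N : ℕ) :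
    ((Finset.range (N + 1)).image w).card ≤
      ((Finset.range N).image fun i => s(w i, w (i + 1))).card + 1 := by
  induction N with
  | zero => simp
  | succ N ih =>
    have h1 : (Finset.range (N + 1 + 1)).image w =
        insert (w (N + 1)) ((Finset.range (N + 1)).image w) := by
      rw [Finset.range_add_one, Finset.image_insert]
    have h2 : (Finset.range (N + 1)).image (fun i => s(w i, w (i + 1))) =
        insert s(w N, w (N + 1)) ((Finset.range N).image fun i => s(w i, w (i + 1))) := by
      rw [Finset.range_add_one, Finset.image_insert]
    rw [h1, h2]
    by_cases h : w (N + 1) ∈ (Finset.range (N + 1)).image w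
    · rw [Finset.insert_eq_of_mem h]
      refine ih.trans ?_
      gcongr
      exact Finset.subset_insert _ _
    · rw [Finset.card_insert_of_notMem h, Finset.card_insert_of_notMem]
      · omega
      · intro h'
        apply h
        simp only [Finset.mem_image, Finset.mem_range] at h' ⊢
        obtain ⟨i, hi, hie⟩ := h'
        rcases Sym2.eq_iff.1 hie with ⟨-, h2⟩ | ⟨h1, -⟩
        · exact ⟨i + 1, by omega, h2⟩
        · exact ⟨i, by omega, h1⟩

theorem card_verts_le [DecidableEq V] (w : Fin (N + 1) → V) :
    (Finset.univ.image w).card ≤ (Finset.univ.image (walkStep w)).card + 1 := by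
  have h := card_image_range_le (fun n => w (Fin.ofNat (N + 1) n)) N
  have hcast : ∀ i : Fin N, Fin.ofNat (N + 1) i = i.castSucc := fun i => by
    ext; simp
  have hsucc : ∀ i : Fin N, Fin.ofNat (N + 1) (i + 1) = i.succ := fun i => by
    ext; simp
  have h1 : (Finset.range (N + 1)).image (fun n => w (Fin.ofNat (N + 1) n)) =
      Finset.univ.image w := by
    ext x
    simp only [Finset.mem_image, Finset.mem_range, Finset.mem_univ, true_and]
    constructor
    · rintro ⟨i, -, rfl⟩; exact ⟨_, rfl⟩
    · rintro ⟨i, rfl⟩; exact ⟨i, i.2, by simp⟩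
  have h2 : (Finset.range N).image
      (fun i => s(w (Fin.ofNat (N + 1) i), w (Fin.ofNat (N + 1) (i + 1)))) =
      Finset.univ.image (walkStep w) := by
    ext x
    simp only [Finset.mem_image, Finset.mem_range, Finset.mem_univ, true_and, walkStep]
    constructor
    · rintro ⟨i, hi, rfl⟩
      exact ⟨⟨i, hi⟩, by rw [← hcast, ← hsucc]⟩
    · rintro ⟨i, rfl⟩
      exact ⟨i, i.2, by rw [← hcast, ← hsucc]⟩
  rwa [h1, h2] at h

theorem Repeated.two_mul_card_image_le {E : Type*} [DecidableEq E] {c : Fin N → E}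
    (hc : Repeated c) : 2 * (Finset.univ.image c).card ≤ N := by
  have h := Finset.mul_card_image_le_card (f := c) Finset.univ 2 (by
    intro b hb
    obtain ⟨i, -, rfl⟩ := Finset.mem_image.1 hb
    obtain ⟨j, hj, hji⟩ := hc i
    rw [← Finset.card_pair hj]
    apply Finset.card_le_card
    intro x hx
    rcases Finset.mem_insert.1 hx with rfl | hx
    · simp [hji]
    · rw [Finset.mem_singleton.1 hx]; simp)
  simpa using h

/-- The starting vertex produces the ratio `n / r`. Each of the other `v - 1` vertices is paid for
by one factor `p`, and `n * p` is at most every factor of the remaining falling factorial, these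
being at least `r - N`. -/
theorem descFactorial_weight_le {n r v e N : ℕ} {p : ℝ} (hp0 : 0 ≤ p) (hp1 : p ≤ 1)
    (hr : n * p + N ≤ r) (hv : 1 ≤ v) (hve : v ≤ e + 1) (he : 2 * e ≤ N) :
    r * (p ^ e * n.descFactorial v) ≤ n * (r.descFactorial v : ℝ) := by
  obtain ⟨v, rfl⟩ : ∃ k, v = k + 1 := ⟨v - 1, by omega⟩
  have hNr : (N : ℝ) ≤ r := by have : 0 ≤ n * p := by positivity
                               linarith
  have hNr' : N ≤ r := by exact_mod_cast hNr
  rcases r with _ | r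
  · simp
  rw [Nat.succ_descFactorial_succ]
  have h1 : ((n.descFactorial (v + 1) : ℕ) : ℝ) ≤ n * (n : ℝ) ^ v := by
    have := Nat.descFactorial_le_pow n (v + 1)
    calc ((n.descFactorial (v + 1) : ℕ) : ℝ) ≤ ((n ^ (v + 1) : ℕ) : ℝ) := by exact_mod_cast this
      _ = _ := by push_cast; ring
  have h2 : ((n : ℝ) * p) ^ v ≤ (r.descFactorial v : ℝ) := by
    have := Nat.pow_sub_le_descFactorial r v
    calc ((n : ℝ) * p) ^ v ≤ (((r + 1 - v : ℕ)) : ℝ) ^ v := by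
          gcongr
          rw [Nat.cast_sub (by omega)]
          have : (v : ℝ) ≤ N := by exact_mod_cast (by omega : v ≤ N)
          push_cast at hr ⊢
          linarith
      _ ≤ _ := by exact_mod_cast this
  have h3 : p ^ e ≤ p ^ v := pow_le_pow_of_le_one hp0 hp1 (by omega)
  calc ((r + 1 : ℕ) : ℝ) * (p ^ e * n.descFactorial (v + 1))
      ≤ ((r + 1 : ℕ) : ℝ) * (p ^ v * (n * (n : ℝ) ^ v)) := by gcongr
    _ = ((r + 1 : ℕ) : ℝ) * n * ((n : ℝ) * p) ^ v := by rw [mul_pow]; ring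
    _ ≤ ((r + 1 : ℕ) : ℝ) * n * (r.descFactorial v : ℝ) := by gcongr
    _ = _ := by push_cast; ring

/-- The closed walks of length `N` all of whose steps are repeated. -/
noncomputable def goodWalks (V : Type*) [Fintype V] (N : ℕ) : Finset (Fin (N + 1) → V) := by
  classical
  exact Finset.univ.filter fun w => w 0 = w (Fin.last N) ∧ Repeated (walkStep w)

theorem mem_goodWalks [Fintype V] {w : Fin (N + 1) → V} :
    w ∈ goodWalks V N ↔ w 0 = w (Fin.last N) ∧ Repeated (walkStep w) := by
  simp [goodWalks]

theorem SameKer.mem_goodWalks [Fintype V] [Fintype W] {w : Fin (N + 1) → V}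
    {u : Fin (N + 1) → W} (h : SameKer w u) (hw : w ∈ goodWalks V N) : u ∈ goodWalks W N := by
  rw [SignedSBM.mem_goodWalks] at hw ⊢
  exact ⟨(h _ _).1 hw.1, h.walkStep.repeated hw.2⟩

/-- Comparison of the weighted number of good walks in a large set with the number of good walks
in a small set. -/
theorem sum_goodWalks_le [Fintype V] [Fintype W] [DecidableEq V] [DecidableEq W] {p : ℝ}
    (hp0 : 0 ≤ p) (hp1 : p ≤ 1) (hN : 0 < N)
    (hr : Fintype.card V * p + N ≤ Fintype.card W) :
    Fintype.card W * ∑ w ∈ goodWalks V N, p ^ (Finset.univ.image (walkStep w)).card ≤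
      Fintype.card V * ((goodWalks W N).card : ℝ) := by
  classical
  set n := Fintype.card V
  set r := Fintype.card W
  have hNr : N ≤ r := by
    have : 0 ≤ n * p := by positivity
    exact_mod_cast (by linarith : (N : ℝ) ≤ r)
  -- Every pattern of a good walk fits into `W`, since `v ≤ N / 2 + 1` and `1 ≤ N ≤ r`. This permits
  -- the division below.
  have hdesc : ∀ w ∈ goodWalks V N, (0 : ℝ) < r.descFactorial (Finset.univ.image w).card := by
    intro w hw
    have h1 := card_verts_le w
    have h2 := (mem_goodWalks.1 hw).2.two_mul_card_image_le
    exact_mod_cast Nat.descFactorial_pos.2 (by omega)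
  -- Double counting of pairs `(w, u)` with the same pattern: the weight of `w` is spread evenly
  -- over its copies `u` in `W`.
  have key : ∑ w ∈ goodWalks V N, p ^ (Finset.univ.image (walkStep w)).card =
      ∑ u ∈ goodWalks W N, p ^ (Finset.univ.image (walkStep u)).card *
        n.descFactorial (Finset.univ.image u).card /
          r.descFactorial (Finset.univ.image u).card := by
    calc _ = ∑ w ∈ goodWalks V N, ∑ u ∈ goodWalks W N, if SameKer w u then
          p ^ (Finset.univ.image (walkStep u)).card /
            r.descFactorial (Finset.univ.image u).card else 0 := by
          refine Finset.sum_congr rfl fun w hw => ?_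
          have : ∀ u : Fin (N + 1) → W, (if SameKer w u then
              p ^ (Finset.univ.image (walkStep u)).card /
                (r.descFactorial (Finset.univ.image u).card : ℝ) else 0) =
              if SameKer w u then p ^ (Finset.univ.image (walkStep w)).card /
                (r.descFactorial (Finset.univ.image w).card : ℝ) else 0 := by
            intro u
            split_ifs with h
            · rw [h.card_image_eq, h.walkStep.card_image_eq]
            · rfl
          simp_rw [this]
          rw [← Finset.sum_filter, Finset.sum_const, nsmul_eq_mul]
          have hf : (goodWalks W N).filter (fun u => SameKer w u) =
              Finset.univ.filter fun u : Fin (N + 1) → W => SameKer w u := by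
            ext u
            simp only [Finset.mem_filter, Finset.mem_univ, true_and, and_iff_right_iff_imp]
            exact fun h => h.mem_goodWalks hw
          rw [hf, card_sameKer, mul_div_cancel₀ _ (hdesc w hw).ne']
      _ = _ := by
          rw [Finset.sum_comm]
          refine Finset.sum_congr rfl fun u hu => ?_
          rw [← Finset.sum_filter, Finset.sum_const, nsmul_eq_mul]
          have hf : (goodWalks V N).filter (fun w => SameKer w u) =
              Finset.univ.filter fun w : Fin (N + 1) → V => SameKer u w := by
            ext w
            simp only [Finset.mem_filter, Finset.mem_univ, true_and]
            exact ⟨fun h => h.2.symm, fun h => ⟨h.mem_goodWalks hu, h.symm⟩⟩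
          rw [hf, card_sameKer]
          ring
  rw [key, Finset.mul_sum, Finset.card_eq_sum_ones, Nat.cast_sum, Finset.mul_sum]
  refine Finset.sum_le_sum fun u hu => ?_
  have h1 := card_verts_le u
  have h2 := (mem_goodWalks.1 hu).2.two_mul_card_image_le
  have h3 : (0 : ℝ) < r.descFactorial (Finset.univ.image u).card := by
    exact_mod_cast Nat.descFactorial_pos.2 (by omega)
  rw [← mul_div_assoc, div_le_iff₀ h3]
  have h4 : 1 ≤ (Finset.univ.image u).card := Finset.card_pos.2 ⟨u 0, by simp⟩
  simpa using descFactorial_weight_le hp0 hp1 hr h4 h1 h2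

/-- The entries of a matrix power as sums over walks. -/
theorem matrix_pow_apply_eq_sum_walks [Fintype V] [DecidableEq V] (M : Matrix V V ℝ) (N : ℕ)
    (a b : V) :
    (M ^ N) a b = ∑ w : Fin (N + 1) → V, if w 0 = a ∧ w (Fin.last N) = b then
      ∏ i : Fin N, M (w i.castSucc) (w i.succ) else 0 := by
  induction N generalizing a with
  | zero =>
    rw [← (Equiv.funUnique (Fin 1) V).symm.sum_comp]
    simp only [pow_zero, Matrix.one_apply, Finset.univ_eq_empty, Finset.prod_empty]
    by_cases h : a = b
    · subst h; simp
    · rw [if_neg h, Finset.sum_eq_zero]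
      intro x _
      rw [if_neg]
      simp only [Equiv.funUnique_symm_apply, uniqueElim_const]
      rintro ⟨rfl, h'⟩
      exact h h'
  | succ N ih =>
    have h : ∑ w : Fin (N + 1 + 1) → V, (if w 0 = a ∧ w (Fin.last (N + 1)) = b then
        ∏ i : Fin (N + 1), M (w i.castSucc) (w i.succ) else 0) =
        ∑ x : V, ∑ w : Fin (N + 1) → V, if x = a ∧ w (Fin.last N) = b then
          M x (w 0) * ∏ i : Fin N, M (w i.castSucc) (w i.succ) else 0 := by
      rw [← (Fin.consEquiv fun _ => V).sum_comp, Fintype.sum_prod_type]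
      simp [Fin.consEquiv, Fin.prod_univ_succ, ← Fin.succ_last]
    rw [h, pow_succ', Matrix.mul_apply, Finset.sum_comm]
    simp only [ih, Finset.mul_sum]
    rw [Finset.sum_comm]
    refine Finset.sum_congr rfl fun w _ => ?_
    rw [Finset.sum_eq_single (w 0) (fun x _ hx => by
        rw [if_neg (fun h => hx h.1.symm), mul_zero]) (by simp),
      Finset.sum_eq_single a (fun x _ hx => if_neg (fun h => hx h.1)) (by simp)]
    simp

theorem trace_pow_eq_sum_walks [Fintype V] [DecidableEq V] (M : Matrix V V ℝ) (N : ℕ) :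
    (M ^ N).trace = ∑ w : Fin (N + 1) → V, if w 0 = w (Fin.last N) then
      ∏ i : Fin N, M (w i.castSucc) (w i.succ) else 0 := by
  simp only [Matrix.trace, Matrix.diag_apply, matrix_pow_apply_eq_sum_walks]
  rw [Finset.sum_comm]
  refine Finset.sum_congr rfl fun w _ => ?_
  rw [Finset.sum_eq_single (w 0)]
  · simp [eq_comm]
  · intro x _ hx
    rw [if_neg (fun h => hx h.1.symm)]
  · simp

end Walks

/-! ### Trace moments of random matrices with independent entries -/

section Moments

variable {E Ω : Type*} [DecidableEq E] [MeasurableSpace Ω] {N : ℕ}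

theorem Repeated.card_fiber_ne_one {c : Fin N → E} (hc : Repeated c) (e : E) :
    (Finset.univ.filter fun i => c i = e).card ≠ 1 := by
  intro h
  obtain ⟨i, hi⟩ := Finset.card_eq_one.1 h
  have hie : c i = e := by
    have : i ∈ Finset.univ.filter fun i => c i = e := by rw [hi]; simp
    exact (Finset.mem_filter.1 this).2
  obtain ⟨j, hj, hji⟩ := hc i
  have : j ∈ Finset.univ.filter fun i => c i = e := by simp [hji, hie]
  rw [hi, Finset.mem_singleton] at this
  exact hj this

theorem exists_card_fiber_eq_one {c : Fin N → E} (hc : ¬ Repeated c) :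
    ∃ e, (Finset.univ.filter fun i => c i = e).card = 1 := by
  simp only [Repeated, not_forall, not_exists, not_and] at hc
  obtain ⟨i, hi⟩ := hc
  refine ⟨c i, Finset.card_eq_one.2 ⟨i, ?_⟩⟩
  ext j
  simp only [Finset.mem_filter, Finset.mem_univ, true_and, Finset.mem_singleton]
  exact ⟨fun h => by_contra fun hne => hi j hne h, fun h => h ▸ rfl⟩

variable [Fintype E]

theorem integral_prod_comp (μ : E → Measure Ω) [∀ e, IsProbabilityMeasure (μ e)]
    (g : E → Ω → ℝ) (c : Fin N → E) :
    ∫ ω, ∏ i, g (c i) (ω (c i)) ∂Measure.pi μ =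
      ∏ e, ∫ x, g e x ^ (Finset.univ.filter fun i => c i = e).card ∂μ e := by
  rw [← integral_fintype_prod_eq_prod (f := fun e x =>
    g e x ^ (Finset.univ.filter fun i => c i = e).card)]
  congr 1
  funext ω
  rw [← Finset.prod_fiberwise Finset.univ c]
  refine Finset.prod_congr rfl fun e _ => ?_
  rw [← Finset.prod_const]
  refine Finset.prod_congr rfl fun i hi => ?_
  rw [(Finset.mem_filter.1 hi).2]

theorem integral_prod_comp_eq_zero (μ : E → Measure Ω) [∀ e, IsProbabilityMeasure (μ e)]
    (g : E → Ω → ℝ) (h0 : ∀ e, ∫ x, g e x ∂μ e = 0) {c : Fin N → E} (hc : ¬ Repeated c) :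
    ∫ ω, ∏ i, g (c i) (ω (c i)) ∂Measure.pi μ = 0 := by
  rw [integral_prod_comp]
  obtain ⟨e, he⟩ := exists_card_fiber_eq_one hc
  refine Finset.prod_eq_zero (Finset.mem_univ e) ?_
  rw [he]
  simpa using h0 e

/-- The integral factors over coordinates. Each one that occurs does so at least twice and
contributes at most `p`; the others contribute `1`. -/
theorem integral_prod_comp_le (μ : E → Measure Ω) [∀ e, IsProbabilityMeasure (μ e)]
    (g : E → Ω → ℝ) {p : ℝ} (hp : ∀ e k, 2 ≤ k → |∫ x, g e x ^ k ∂μ e| ≤ p)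
    {c : Fin N → E} (hc : Repeated c) :
    ∫ ω, ∏ i, g (c i) (ω (c i)) ∂Measure.pi μ ≤ p ^ (Finset.univ.image c).card := by
  rw [integral_prod_comp]
  refine (le_abs_self _).trans ?_
  rw [Finset.abs_prod]
  calc _ ≤ ∏ e, (if e ∈ Finset.univ.image c then p else 1) := by
        refine Finset.prod_le_prod (fun _ _ => abs_nonneg _) fun e _ => ?_
        split_ifs with he
        · obtain ⟨i, -, rfl⟩ := Finset.mem_image.1 he
          refine hp _ _ ?_
          have h1 := hc.card_fiber_ne_one (c i)
          have h2 : 0 < (Finset.univ.filter fun j => c j = c i).card :=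
            Finset.card_pos.2 ⟨i, by simp⟩
          omega
        · have : (Finset.univ.filter fun i => c i = e) = ∅ := by
            ext i
            simp only [Finset.mem_filter, Finset.mem_univ, true_and, Finset.notMem_empty,
              iff_false]
            rintro rfl
            exact he (Finset.mem_image_of_mem _ (Finset.mem_univ i))
          simp [this]
    _ = _ := by
        rw [Finset.prod_ite, Finset.prod_const, Finset.prod_const_one, mul_one]
        congr 2
        ext e
        simp

theorem one_le_integral_prod_comp (μ : E → Measure Ω) [∀ e, IsProbabilityMeasure (μ e)]
    (g : E → Ω → ℝ) (hg : ∀ e k, 2 ≤ k → 1 ≤ ∫ x, g e x ^ k ∂μ e)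
    {c : Fin N → E} (hc : Repeated c) :
    1 ≤ ∫ ω, ∏ i, g (c i) (ω (c i)) ∂Measure.pi μ := by
  rw [integral_prod_comp]
  have : ∏ e : E, (1 : ℝ) ≤
      ∏ e, ∫ x, g e x ^ (Finset.univ.filter fun i => c i = e).card ∂μ e := by
    refine Finset.prod_le_prod (fun _ _ => zero_le_one) fun e _ => ?_
    rcases Nat.lt_or_ge (Finset.univ.filter fun i => c i = e).card 2 with h | h
    · have : (Finset.univ.filter fun i => c i = e).card = 0 := by
        have := hc.card_fiber_ne_one e
        omega
      simp [this]
    · exact hg e _ h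
  simpa using this

end Moments

/-! ### Symmetric matrices driven by independent pairs -/

section PairMatrix

variable {Ω : Type*} {n : ℕ}

/-- The pair formed by two distinct nodes. -/
def pairOf (i j : Fin n) (h : i ≠ j) : Pairs n :=
  if hij : i < j then ⟨(i, j), hij⟩ else ⟨(j, i), lt_of_le_of_ne (not_lt.1 hij) h.symm⟩

theorem sym2_pairOf (i j : Fin n) (h : i ≠ j) :
    s((pairOf i j h).1.1, (pairOf i j h).1.2) = s(i, j) := by
  unfold pairOf
  split_ifs
  · rfl
  · exact Sym2.eq_swap

theorem pairOf_eq_iff {i j i' j' : Fin n} (h : i ≠ j) (h' : i' ≠ j') :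
    pairOf i j h = pairOf i' j' h' ↔ s(i, j) = s(i', j') := by
  constructor
  · intro heq
    rw [← sym2_pairOf i j h, heq, sym2_pairOf]
  · intro heq
    rw [← sym2_pairOf i j h, ← sym2_pairOf i' j' h', Sym2.eq_iff] at heq
    have h1 := (pairOf i j h).2
    have h2 := (pairOf i' j' h').2
    rcases heq with ⟨h3, h4⟩ | ⟨h3, h4⟩
    · exact Subtype.ext (Prod.ext h3 h4)
    · rw [h3, h4] at h1
      exact absurd h1 (lt_asymm h2)

/-- The symmetric matrix with zero diagonal whose off-diagonal entries are functions of the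
outcomes attached to the pairs. -/
def pairMatrix (g : Pairs n → Ω → ℝ) (ω : Pairs n → Ω) : Matrix (Fin n) (Fin n) ℝ :=
  Matrix.of fun i j =>
    if h : i < j then g ⟨(i, j), h⟩ (ω ⟨(i, j), h⟩)
    else if h : j < i then g ⟨(j, i), h⟩ (ω ⟨(j, i), h⟩)
    else 0

theorem pairMatrix_apply_self (g : Pairs n → Ω → ℝ) (ω : Pairs n → Ω) (i : Fin n) :
    pairMatrix g ω i i = 0 := by
  simp [pairMatrix]

theorem pairMatrix_apply (g : Pairs n → Ω → ℝ) (ω : Pairs n → Ω) {i j : Fin n} (h : i ≠ j) :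
    pairMatrix g ω i j = g (pairOf i j h) (ω (pairOf i j h)) := by
  unfold pairMatrix pairOf
  by_cases hij : i < j
  · simp [hij]
  · have hji : j < i := lt_of_le_of_ne (not_lt.1 hij) h.symm
    simp [hij, hji]

theorem isHermitian_pairMatrix (g : Pairs n → Ω → ℝ) (ω : Pairs n → Ω) :
    (pairMatrix g ω).IsHermitian := by
  ext i j
  simp only [Matrix.conjTranspose_apply, star_trivial]
  by_cases h : i = j
  · rw [h]
  · rw [pairMatrix_apply _ _ h, pairMatrix_apply _ _ (Ne.symm h),
      (pairOf_eq_iff (Ne.symm h) h).2 Sym2.eq_swap]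

variable [MeasurableSpace Ω] [Finite Ω] [MeasurableSingletonClass Ω]

theorem integral_trace_pow_pairMatrix_le {N : ℕ} (μ : Pairs n → Measure Ω)
    [∀ e, IsProbabilityMeasure (μ e)] (g : Pairs n → Ω → ℝ) {p : ℝ} (hp0 : 0 ≤ p)
    (h0 : ∀ e, ∫ x, g e x ∂μ e = 0) (hp : ∀ e k, 2 ≤ k → |∫ x, g e x ^ k ∂μ e| ≤ p) :
    ∫ ω, (pairMatrix g ω ^ N).trace ∂Measure.pi μ ≤
      ∑ w ∈ goodWalks (Fin n) N, p ^ (Finset.univ.image (walkStep w)).card := by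
  classical
  simp only [trace_pow_eq_sum_walks]
  rw [integral_finsetSum _ fun _ _ => Integrable.of_finite, goodWalks, Finset.sum_filter]
  refine Finset.sum_le_sum fun w _ => ?_
  by_cases hcl : w 0 = w (Fin.last N)
  swap
  · simp [hcl]
  simp only [hcl, if_true, true_and]
  -- A walk with a stationary step meets the zero diagonal and contributes nothing. Otherwise its
  -- steps are genuine pairs and independence applies.
  by_cases hloop : ∃ i : Fin N, w i.castSucc = w i.succ
  · obtain ⟨i, hi⟩ := hloop
    have : ∀ ω : Pairs n → Ω, ∏ i : Fin N, pairMatrix g ω (w i.castSucc) (w i.succ) = 0 :=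
      fun ω => Finset.prod_eq_zero (Finset.mem_univ i) (by rw [hi, pairMatrix_apply_self])
    simp only [this, integral_zero]
    split_ifs <;> positivity
  · push Not at hloop
    set c : Fin N → Pairs n := fun i => pairOf _ _ (hloop i)
    have hker : SameKer c (walkStep w) := fun i j => pairOf_eq_iff _ _
    simp only [pairMatrix_apply _ _ (hloop _)]
    split_ifs with hrep
    · rw [← hker.card_image_eq]
      exact integral_prod_comp_le μ g hp (hker.symm.repeated hrep)
    · exact (integral_prod_comp_eq_zero μ g h0 (c := c)
        fun h => hrep (hker.repeated h)).le

end PairMatrix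

/-! ### Comparison with a small dense reference matrix -/

section Reference

/-- The entries of the reference matrix. -/
noncomputable def refEntry (b : Bool) : ℝ := if b then 4 else -2

/-- The law of one coordinate of the reference matrix. -/
noncomputable def refMeasure : Measure Bool := bernoulliMeasure true false ⟨1 / 3, by norm_num, by norm_num⟩

instance : IsProbabilityMeasure refMeasure := by unfold refMeasure; infer_instance

theorem integral_refMeasure (f : Bool → ℝ) :
    ∫ b, f b ∂refMeasure = 1 / 3 * f true + 2 / 3 * f false := by
  rw [refMeasure, integral_bernoulliMeasure]
  simp only [smul_eq_mul]
  norm_num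

/-- The reference matrix: symmetric, with independent centred entries. -/
noncomputable def refMatrix {r : ℕ} (ω : Sym2 (Fin r) → Bool) : Matrix (Fin r) (Fin r) ℝ :=
  Matrix.of fun i j => refEntry (ω s(i, j))

/-- The reference law is skewed because a symmetric one would have vanishing odd moments. Its
moments `(4 ^ k + 2 * (-2) ^ k) / 3` are at least `1` for `k ≥ 2`, so every good walk counts at
least once. Diagonal entries are random too, since good walks may contain loops. -/
theorem card_goodWalks_le_integral_trace_pow_refMatrix (r N : ℕ) :
    ((goodWalks (Fin r) N).card : ℝ) ≤
      ∫ ω, ((refMatrix ω : Matrix (Fin r) (Fin r) ℝ) ^ N).trace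
        ∂Measure.pi fun _ => refMeasure := by
  classical
  simp only [trace_pow_eq_sum_walks]
  rw [integral_finsetSum _ fun _ _ => Integrable.of_finite, goodWalks, Finset.card_eq_sum_ones,
    Nat.cast_sum, Finset.sum_filter]
  refine Finset.sum_le_sum fun w _ => ?_
  by_cases hcl : w 0 = w (Fin.last N)
  swap
  · simp [hcl]
  simp only [hcl, if_true, true_and, refMatrix, Matrix.of_apply, Nat.cast_one]
  split_ifs with hrep
  · refine one_le_integral_prod_comp (fun _ => refMeasure) (fun _ => refEntry) ?_ hrep
    intro _ k hk
    rw [integral_refMeasure]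
    simp only [refEntry, if_true, Bool.false_eq_true, if_false]
    have h1 : (4 : ℝ) ≤ 2 ^ k := by
      calc (4 : ℝ) = 2 ^ 2 := by norm_num
        _ ≤ 2 ^ k := pow_le_pow_right₀ (by norm_num) hk
    have h2 : -(2 : ℝ) ^ k ≤ (-2) ^ k := by
      have := neg_abs_le ((-2 : ℝ) ^ k)
      rwa [abs_pow, abs_neg, abs_two] at this
    have h3 : (4 : ℝ) ^ k = 2 ^ k * 2 ^ k := by rw [← mul_pow]; norm_num
    nlinarith
  · exact (integral_prod_comp_eq_zero (fun _ => refMeasure) (fun _ => refEntry)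
      (fun _ => by rw [integral_refMeasure]; norm_num [refEntry]) hrep).ge

theorem integral_trace_pow_pairMatrix_le_refMatrix {Ω : Type*} [MeasurableSpace Ω] [Finite Ω]
    [MeasurableSingletonClass Ω] {n r N : ℕ} (μ : Pairs n → Measure Ω)
    [∀ e, IsProbabilityMeasure (μ e)] (g : Pairs n → Ω → ℝ) {p : ℝ} (hp0 : 0 ≤ p) (hp1 : p ≤ 1)
    (h0 : ∀ e, ∫ x, g e x ∂μ e = 0) (hp : ∀ e k, 2 ≤ k → |∫ x, g e x ^ k ∂μ e| ≤ p)
    (hN : 0 < N) (hr : n * p + N ≤ r) :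
    r * ∫ ω, (pairMatrix g ω ^ N).trace ∂Measure.pi μ ≤
      n * ∫ ω, ((refMatrix ω : Matrix (Fin r) (Fin r) ℝ) ^ N).trace
        ∂Measure.pi fun _ => refMeasure := by
  have h1 := sum_goodWalks_le (V := Fin n) (W := Fin r) hp0 hp1 hN (by simpa using hr)
  rw [Fintype.card_fin, Fintype.card_fin] at h1
  calc _ ≤ _ := mul_le_mul_of_nonneg_left
        (integral_trace_pow_pairMatrix_le (N := N) μ g hp0 h0 hp) (Nat.cast_nonneg r)
    _ ≤ _ := h1
    _ ≤ _ := mul_le_mul_of_nonneg_left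
        (card_goodWalks_le_integral_trace_pow_refMatrix r N) (Nat.cast_nonneg n)

end Reference

/-! ### Norm moments of the reference matrix -/

section OperatorNorm

/-- A `1`-separated subset of the ball of radius `2` with the largest possible cardinality is a net:
a point far from all of it could be added. The volume bound `5 ^ r` makes this maximum exist. -/
theorem exists_net (r : ℕ) : ∃ s : Finset (EuclideanSpace ℝ (Fin r)), s.card ≤ 5 ^ r ∧
    (∀ x ∈ s, ‖x‖ ≤ 2) ∧ ∀ x : EuclideanSpace ℝ (Fin r), ‖x‖ ≤ 2 → ∃ a ∈ s, ‖x - a‖ ≤ 1 := by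
  classical
  let S : Set ℕ := {N | ∃ s : Finset (EuclideanSpace ℝ (Fin r)), s.card = N ∧
    (∀ c ∈ s, ‖c‖ ≤ 2) ∧ ∀ c ∈ s, ∀ d ∈ s, c ≠ d → 1 ≤ ‖c - d‖}
  have hS : ∀ N ∈ S, N ≤ 5 ^ r := by
    rintro N ⟨s, rfl, h1, h2⟩
    simpa using Besicovitch.card_le_of_separated s h1 h2
  have hmem : sSup S ∈ S := Nat.sSup_mem ⟨0, ∅, by simp⟩ ⟨5 ^ r, hS⟩
  obtain ⟨s, hcard, h1, h2⟩ := hmem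
  refine ⟨s, hcard ▸ hS _ ⟨s, hcard, h1, h2⟩, h1, fun x hx => ?_⟩
  by_contra! hfar
  have hxs : x ∉ s := fun h => by
    have := hfar x h
    simp at this
    linarith
  have : s.card + 1 ∈ S := by
    refine ⟨insert x s, Finset.card_insert_of_notMem hxs, ?_, ?_⟩
    · intro c hc
      rcases Finset.mem_insert.1 hc with rfl | hc
      · exact hx
      · exact h1 c hc
    · intro c hc d hd hcd
      rcases Finset.mem_insert.1 hc with rfl | hc' <;>
        rcases Finset.mem_insert.1 hd with rfl | hd'
      · exact absurd rfl hcd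
      · exact (hfar d hd').le
      · rw [norm_sub_rev]; exact (hfar c hc').le
      · exact h2 c hc' d hd' hcd
  have := le_csSup ⟨5 ^ r, hS⟩ this
  omega

/-- Approximating vectors of norm `2` within distance `1` gives first `2‖T b‖ ≤ B + ‖T b‖` for `b`
in the net, then `2‖T‖ ≤ B + ‖T‖`. The radius `2` is why no constant is lost. -/
theorem opNorm_le_of_net {F : Type*} [NormedAddCommGroup F] [InnerProductSpace ℝ F] {s : Finset F}
    (hs : ∀ x : F, ‖x‖ ≤ 2 → ∃ a ∈ s, ‖x - a‖ ≤ 1) (T : F →L[ℝ] F) {B : ℝ}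
    (hB : ∀ a ∈ s, ∀ b ∈ s, inner ℝ a (T b) ≤ B) : ‖T‖ ≤ B := by
  have hscale : ∀ v : F, v ≠ 0 → ‖(2 / ‖v‖) • v‖ ≤ 2 := fun v hv => by
    have : 0 < ‖v‖ := norm_pos_iff.2 hv
    rw [norm_smul, Real.norm_of_nonneg (by positivity), div_mul_cancel₀ _ this.ne']
  have key : ∀ b ∈ s, ‖T b‖ ≤ B := by
    intro b hb
    rcases eq_or_ne (T b) 0 with h0 | h0
    · obtain ⟨a, ha, -⟩ := hs 0 (by simp)
      simpa [h0] using hB a ha b hb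
    · obtain ⟨a, ha, hxa⟩ := hs _ (hscale _ h0)
      have hpos : 0 < ‖T b‖ := norm_pos_iff.2 h0
      have h1 : inner ℝ ((2 / ‖T b‖) • T b) (T b) = 2 * ‖T b‖ := by
        rw [real_inner_smul_left, real_inner_self_eq_norm_sq]
        field_simp
      have h2 : inner ℝ ((2 / ‖T b‖) • T b) (T b) =
          inner ℝ a (T b) + inner ℝ ((2 / ‖T b‖) • T b - a) (T b) := by
        rw [← inner_add_left]; congr 1; abel
      have h3 := real_inner_le_norm ((2 / ‖T b‖) • T b - a) (T b)
      have h4 := hB a ha b hb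
      nlinarith
  have hB0 : 0 ≤ B := by
    obtain ⟨a, ha, -⟩ := hs 0 (by simp)
    exact (norm_nonneg _).trans (key a ha)
  have h : ‖T‖ ≤ (B + ‖T‖) / 2 := by
    refine T.opNorm_le_bound (by positivity) fun x => ?_
    rcases eq_or_ne x 0 with rfl | hx
    · simp
    have hpos : 0 < ‖x‖ := norm_pos_iff.2 hx
    obtain ⟨b, hb, hxb⟩ := hs _ (hscale _ hx)
    have h1 : ‖T ((2 / ‖x‖) • x)‖ ≤ B + ‖T‖ := by
      calc ‖T ((2 / ‖x‖) • x)‖ = ‖T b + T ((2 / ‖x‖) • x - b)‖ := by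
            rw [← map_add]; congr 2; abel
        _ ≤ ‖T b‖ + ‖T ((2 / ‖x‖) • x - b)‖ := norm_add_le _ _
        _ ≤ B + ‖T‖ * 1 := add_le_add (key b hb)
            ((T.le_opNorm _).trans (mul_le_mul_of_nonneg_left hxb (norm_nonneg _)))
        _ = _ := by ring
    rw [map_smul, norm_smul, Real.norm_of_nonneg (by positivity), div_mul_eq_mul_div,
      div_le_iff₀ hpos] at h1
    linarith
  linarith

theorem opNorm_pow_le_sum_net {F : Type*} [NormedAddCommGroup F] [InnerProductSpace ℝ F]
    {s : Finset F}
    (hs : ∀ x : F, ‖x‖ ≤ 2 → ∃ a ∈ s, ‖x - a‖ ≤ 1) (T : F →L[ℝ] F) {N : ℕ} (hN : Even N) :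
    ‖T‖ ^ N ≤ ∑ a ∈ s, ∑ b ∈ s, (inner ℝ a (T b)) ^ N := by
  obtain ⟨a₀, ha₀, -⟩ := hs 0 (by simp)
  obtain ⟨⟨a, b⟩, hab, hmax⟩ := Finset.exists_max_image (s ×ˢ s)
    (fun x : F × F => inner ℝ x.1 (T x.2)) ⟨(a₀, a₀), Finset.mk_mem_product ha₀ ha₀⟩
  have h := opNorm_le_of_net hs T (B := inner ℝ a (T b))
    fun a' ha' b' hb' => hmax (a', b') (Finset.mk_mem_product ha' hb')
  rw [← Finset.sum_product']
  refine (pow_le_pow_left₀ (norm_nonneg _) h N).trans ?_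
  exact Finset.single_le_sum (f := fun x : F × F => (inner ℝ x.1 (T x.2)) ^ N)
    (fun x _ => hN.pow_nonneg _) hab

theorem trace_pow_le_opNorm {n : Type*} [Fintype n] [DecidableEq n] (M : Matrix n n ℝ) (N : ℕ) :
    (M ^ N).trace ≤ Fintype.card n * ‖Matrix.toEuclideanCLM (𝕜 := ℝ) M‖ ^ N := by
  have h : ∀ i, (M ^ N) i i ≤ ‖Matrix.toEuclideanCLM (𝕜 := ℝ) M‖ ^ N := by
    intro i
    have h1 : (M ^ N) i i = inner ℝ (EuclideanSpace.single i (1 : ℝ))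
        (Matrix.toEuclideanCLM (𝕜 := ℝ) (M ^ N) (EuclideanSpace.single i (1 : ℝ))) := by
      rw [EuclideanSpace.inner_single_left, Matrix.ofLp_toEuclideanCLM]
      simp
    rw [h1, map_pow]
    refine (real_inner_le_norm _ _).trans ?_
    have h2 := (Matrix.toEuclideanCLM (𝕜 := ℝ) M ^ N).le_opNorm
      (EuclideanSpace.single i (1 : ℝ))
    simp only [PiLp.norm_single, norm_one, one_mul, mul_one] at h2 ⊢
    have : Nonempty n := ⟨i⟩
    exact h2.trans (norm_pow_le _ _)
  calc (M ^ N).trace = ∑ i, (M ^ N) i i := rfl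
    _ ≤ ∑ _i : n, ‖Matrix.toEuclideanCLM (𝕜 := ℝ) M‖ ^ N := Finset.sum_le_sum fun i _ => h i
    _ = _ := by simp

end OperatorNorm

/-! ### Subgaussian moments of bilinear forms -/

section ReferenceNorm

/-- Hoeffding's lemma on `[-2, 4]`, with variance proxy `(6 / 2) ^ 2 = 9`. -/
theorem integral_exp_refEntry_le (t : ℝ) :
    ∫ b, Real.exp (t * refEntry b) ∂refMeasure ≤ Real.exp (9 / 2 * t ^ 2) := by
  have h := (hasSubgaussianMGF_of_mem_Icc_of_integral_eq_zero (X := refEntry) (μ := refMeasure)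
    (a := -2) (b := 4) (measurable_of_finite _).aemeasurable
    (ae_of_all _ fun b => by cases b <;> norm_num [refEntry])
    (by rw [integral_refMeasure]; norm_num [refEntry])).mgf_le t
  rw [mgf] at h
  refine h.trans (le_of_eq ?_)
  congr 1
  have : ‖(4 : ℝ) - -2‖ = 6 := by norm_num
  push_cast
  rw [this]
  ring

theorem integral_exp_sum_refEntry_le {E : Type*} [Fintype E] (c : E → ℝ) :
    ∫ ω, Real.exp (∑ e, c e * refEntry (ω e)) ∂(Measure.pi fun _ : E => refMeasure) ≤
      Real.exp (9 / 2 * ∑ e, c e ^ 2) := by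
  simp only [Real.exp_sum]
  rw [integral_fintype_prod_eq_prod (f := fun e b => Real.exp (c e * refEntry b)),
    Finset.mul_sum, Real.exp_sum]
  exact Finset.prod_le_prod (fun e _ => integral_nonneg fun _ => (Real.exp_pos _).le)
    fun e _ => integral_exp_refEntry_le _

/-- The coefficient of the coordinate `e` in the bilinear form of the reference matrix. -/
noncomputable def refCoeff {r : ℕ} (a b : Fin r → ℝ) (e : Sym2 (Fin r)) : ℝ :=
  ∑ x : Fin r × Fin r with s(x.1, x.2) = e, a x.1 * b x.2

theorem sum_refCoeff_mul {r : ℕ} (a b : Fin r → ℝ) (f : Sym2 (Fin r) → ℝ) :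
    ∑ e, refCoeff a b e * f e = ∑ x : Fin r × Fin r, a x.1 * b x.2 * f s(x.1, x.2) := by
  rw [← Finset.sum_fiberwise Finset.univ (fun x : Fin r × Fin r => s(x.1, x.2))]
  refine Finset.sum_congr rfl fun e _ => ?_
  rw [refCoeff, Finset.sum_mul]
  refine Finset.sum_congr rfl fun x hx => ?_
  rw [(Finset.mem_filter.1 hx).2]

/-- An unordered pair collects at most two ordered ones, so Cauchy–Schwarz costs a factor `2`. -/
theorem sum_refCoeff_sq_le {r : ℕ} (a b : Fin r → ℝ) :
    ∑ e, refCoeff a b e ^ 2 ≤ 2 * ((∑ i, a i ^ 2) * ∑ j, b j ^ 2) := by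
  have hcard : ∀ e : Sym2 (Fin r),
      (Finset.univ.filter fun x : Fin r × Fin r => s(x.1, x.2) = e).card ≤ 2 := by
    intro e
    induction e with
    | _ i j =>
      refine (Finset.card_le_card (t := {(i, j), (j, i)}) ?_).trans Finset.card_le_two
      intro x hx
      rcases Sym2.eq_iff.1 (Finset.mem_filter.1 hx).2 with ⟨h1, h2⟩ | ⟨h1, h2⟩
      · simp [Prod.ext_iff, h1, h2]
      · simp [Prod.ext_iff, h1, h2]
  calc ∑ e, refCoeff a b e ^ 2
      ≤ ∑ e, 2 * ∑ x : Fin r × Fin r with s(x.1, x.2) = e, (a x.1 * b x.2) ^ 2 := by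
        refine Finset.sum_le_sum fun e _ => ?_
        refine sq_sum_le_card_mul_sum_sq.trans ?_
        refine mul_le_mul_of_nonneg_right ?_ (Finset.sum_nonneg fun _ _ => sq_nonneg _)
        exact_mod_cast hcard e
    _ = 2 * ∑ x : Fin r × Fin r, (a x.1 * b x.2) ^ 2 := by
        rw [← Finset.mul_sum, Finset.sum_fiberwise]
    _ = _ := by
        rw [Fintype.sum_prod_type, Finset.sum_mul_sum]
        simp only [mul_pow]

theorem inner_refMatrix {r : ℕ} (ω : Sym2 (Fin r) → Bool) (a b : EuclideanSpace ℝ (Fin r)) :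
    inner ℝ a (Matrix.toEuclideanCLM (𝕜 := ℝ) (refMatrix ω) b) =
      ∑ e, refCoeff a b e * refEntry (ω e) := by
  rw [sum_refCoeff_mul, Fintype.sum_prod_type, Matrix.inner_toEuclideanCLM]
  simp only [dotProduct, Matrix.mulVec, refMatrix, Matrix.of_apply, Finset.mul_sum]
  refine Finset.sum_congr rfl fun i _ => Finset.sum_congr rfl fun j _ => ?_
  ring

theorem pow_le_factorial_mul_exp {N : ℕ} (hN : Even N) {t : ℝ} (ht : 0 < t) (z : ℝ) :
    z ^ N ≤ N.factorial / t ^ N * (Real.exp (t * z) + Real.exp (-t * z)) := by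
  have h1 := Real.pow_div_factorial_le_exp |t * z| (abs_nonneg _) N
  have h2 : Real.exp |t * z| ≤ Real.exp (t * z) + Real.exp (-t * z) := by
    rcases abs_cases (t * z) with ⟨h, -⟩ | ⟨h, -⟩ <;> rw [h]
    · linarith [Real.exp_pos (-t * z)]
    · rw [neg_mul]; linarith [Real.exp_pos (t * z)]
  rw [hN.pow_abs, mul_pow, div_le_iff₀ (by positivity)] at h1
  rw [div_mul_eq_mul_div, le_div_iff₀ (by positivity)]
  have h3 : (0 : ℝ) < N.factorial := by positivity
  nlinarith

theorem integral_sum_refEntry_pow_le {E : Type*} [Fintype E] (c : E → ℝ)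
    (hc : ∑ e, c e ^ 2 ≤ 32) {m : ℕ} (hm : 0 < m) :
    ∫ ω, (∑ e, c e * refEntry (ω e)) ^ (2 * m) ∂(Measure.pi fun _ : E => refMeasure) ≤
      2 * (2 * m) ^ m * Real.exp (288 * m) := by
  classical
  have hm' : (0 : ℝ) < 2 * m := by positivity
  -- This `t` balances the two factors: the exponent is at most `9 / 2 * 2m * 32 = 288m`, while
  -- `(2m)! / t ^ (2m) ≤ (2m) ^ m`. The bound `32` is `2 * 4 * 4`, for net vectors of norm at most
  -- `2`.
  set t : ℝ := √(2 * m)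
  have ht : 0 < t := Real.sqrt_pos.2 hm'
  have ht2 : t ^ 2 = 2 * m := Real.sq_sqrt hm'.le
  have hexp : ∀ u : ℝ, u ^ 2 = 2 * m →
      ∫ ω, Real.exp (u * ∑ e, c e * refEntry (ω e)) ∂(Measure.pi fun _ : E => refMeasure) ≤
        Real.exp (288 * m) := by
    intro u hu
    have := integral_exp_sum_refEntry_le fun e => u * c e
    simp only [mul_assoc, ← Finset.mul_sum, mul_pow] at this
    refine this.trans (Real.exp_le_exp.2 ?_)
    rw [hu]
    nlinarith
  calc _ ≤ ∫ ω, ((2 * m).factorial / t ^ (2 * m) *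
          (Real.exp (t * ∑ e, c e * refEntry (ω e)) +
            Real.exp (-t * ∑ e, c e * refEntry (ω e)))) ∂(Measure.pi fun _ : E => refMeasure) :=
        integral_mono Integrable.of_finite Integrable.of_finite
          fun ω => pow_le_factorial_mul_exp (even_two_mul m) ht _
    _ ≤ (2 * m).factorial / t ^ (2 * m) * (Real.exp (288 * m) + Real.exp (288 * m)) := by
        rw [integral_const_mul, integral_add Integrable.of_finite Integrable.of_finite]
        gcongr
        · exact hexp t ht2
        · exact hexp (-t) (by rw [neg_sq, ht2])
    _ ≤ (2 * m) ^ m * (Real.exp (288 * m) + Real.exp (288 * m)) := by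
        gcongr
        rw [div_le_iff₀ (by positivity), pow_mul, ht2, ← pow_add, ← two_mul]
        exact_mod_cast Nat.factorial_le_pow (2 * m)
    _ = _ := by ring

/-- The maximum of the bilinear form over pairs of net points is replaced by the sum over all pairs,
at most `5 ^ r * 5 ^ r = 25 ^ r` of them. -/
theorem integral_trace_pow_refMatrix_le (r : ℕ) {m : ℕ} (hm : 0 < m) :
    ∫ ω, ((refMatrix ω : Matrix (Fin r) (Fin r) ℝ) ^ (2 * m)).trace
        ∂(Measure.pi fun _ => refMeasure) ≤
      r * (25 ^ r * (2 * (2 * m) ^ m * Real.exp (288 * m))) := by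
  obtain ⟨s, hcard, hnorm, hs⟩ := exists_net r
  set K : ℝ := 2 * (2 * m) ^ m * Real.exp (288 * m)
  have hK : 0 ≤ K := by positivity
  have hsq : ∀ a ∈ s, ∑ i, a i ^ 2 ≤ 4 := by
    intro a ha
    have := hnorm a ha
    have h2 := EuclideanSpace.real_norm_sq_eq a
    rw [← h2]
    nlinarith [norm_nonneg a]
  have hterm : ∀ a ∈ s, ∀ b ∈ s, ∫ ω : Sym2 (Fin r) → Bool,
      (inner ℝ a (Matrix.toEuclideanCLM (𝕜 := ℝ) (refMatrix ω) b)) ^ (2 * m)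
        ∂(Measure.pi fun _ => refMeasure) ≤ K := by
    intro a ha b hb
    simp only [inner_refMatrix]
    refine integral_sum_refEntry_pow_le _ ((sum_refCoeff_sq_le _ _).trans ?_) hm
    have h1 : 0 ≤ ∑ i, b i ^ 2 := Finset.sum_nonneg fun _ _ => sq_nonneg _
    nlinarith [hsq a ha, hsq b hb]
  calc _ ≤ ∫ ω : Sym2 (Fin r) → Bool, r * ∑ a ∈ s, ∑ b ∈ s,
        (inner ℝ a (Matrix.toEuclideanCLM (𝕜 := ℝ) (refMatrix ω) b)) ^ (2 * m)
        ∂(Measure.pi fun _ => refMeasure) := by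
        refine integral_mono Integrable.of_finite Integrable.of_finite fun ω => ?_
        refine (trace_pow_le_opNorm _ _).trans ?_
        rw [Fintype.card_fin]
        exact mul_le_mul_of_nonneg_left (opNorm_pow_le_sum_net hs _ (even_two_mul m))
          (Nat.cast_nonneg r)
    _ = r * ∑ a ∈ s, ∑ b ∈ s, ∫ ω : Sym2 (Fin r) → Bool,
        (inner ℝ a (Matrix.toEuclideanCLM (𝕜 := ℝ) (refMatrix ω) b)) ^ (2 * m)
        ∂(Measure.pi fun _ => refMeasure) := by
        rw [integral_const_mul, integral_finsetSum _ fun _ _ => Integrable.of_finite]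
        congr 1
        refine Finset.sum_congr rfl fun a _ => ?_
        rw [integral_finsetSum _ fun _ _ => Integrable.of_finite]
    _ ≤ r * ∑ a ∈ s, ∑ b ∈ s, K := by
        gcongr with a ha b hb
        exact hterm a ha b hb
    _ = r * ((s.card * s.card : ℕ) * K) := by
        simp only [Finset.sum_const, nsmul_eq_mul]; push_cast; ring
    _ ≤ r * (25 ^ r * K) := by
        gcongr
        have : s.card * s.card ≤ 25 ^ r :=
          (Nat.mul_le_mul hcard hcard).trans (by rw [← mul_pow]; norm_num)
        exact_mod_cast this

end ReferenceNorm

/-! ### Eigenvalues of perturbed symmetric operators -/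

section Symmetric

variable {F : Type*} [NormedAddCommGroup F] [InnerProductSpace ℝ F] [FiniteDimensional ℝ F]
  {T : F →ₗ[ℝ] F} (hT : T.IsSymmetric) {n : ℕ} (hn : Module.finrank ℝ F = n)

theorem inner_apply_self_eq_sum (x : F) :
    inner ℝ x (T x) =
      ∑ i, hT.eigenvalues hn i * (inner ℝ (hT.eigenvectorBasis hn i) x) ^ 2 := by
  rw [← (hT.eigenvectorBasis hn).sum_inner_mul_inner]
  refine Finset.sum_congr rfl fun i _ => ?_
  rw [← hT, hT.apply_eigenvectorBasis, real_inner_comm]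
  simp only [RCLike.ofReal_real_eq_id, id_eq, real_inner_smul_left]
  ring

/-- Lower bound for an eigenvalue from a subspace on which the quadratic form is large. -/
theorem le_eigenvalues_of_orthonormal (j : Fin n) {c : ℝ} (u : Fin (j + 1) → F)
    (hu : Orthonormal ℝ u)
    (h : ∀ a : Fin (j + 1) → ℝ, c * ‖∑ i, a i • u i‖ ^ 2 ≤
      inner ℝ (∑ i, a i • u i) (T (∑ i, a i • u i))) :
    c ≤ hT.eigenvalues hn j := by
  let b := hT.eigenvectorBasis hn
  let f : (Fin (j + 1) → ℝ) →ₗ[ℝ] (Fin j → ℝ) :=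
    LinearMap.pi fun i => (innerₛₗ ℝ (b (i.castLE j.2.le))).comp (Fintype.linearCombination ℝ u)
  -- There are `j + 1` coefficients and `j` equations, so some nonzero vector of the span is
  -- orthogonal to the eigenvectors of index below `j`.
  have hker : LinearMap.ker f ≠ ⊥ := LinearMap.ker_ne_bot_of_finrank_lt (by simp)
  obtain ⟨a, ha, ha0⟩ := (Submodule.ne_bot_iff _).1 hker
  set x := ∑ i, a i • u i with hx
  have hxb : ∀ i : Fin n, i < j → inner ℝ (b i) x = 0 := by
    intro i hi
    have := congrFun (LinearMap.mem_ker.1 ha) ⟨i, hi⟩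
    simpa [f, Fintype.linearCombination_apply] using this
  have hx0 : 0 < ‖x‖ ^ 2 := by
    have hxne : x ≠ 0 := fun h0 => ha0 (funext fun i =>
      Fintype.linearIndependent_iff.1 hu.linearIndependent a h0 i)
    have := norm_pos_iff.2 hxne
    positivity
  have h1 : inner ℝ x (T x) ≤ hT.eigenvalues hn j * ‖x‖ ^ 2 := by
    rw [inner_apply_self_eq_sum hT hn, ← b.sum_sq_inner_right, Finset.mul_sum]
    refine Finset.sum_le_sum fun i _ => ?_
    rcases lt_or_ge i j with hij | hij
    · rw [hxb i hij]; simp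
    · exact mul_le_mul_of_nonneg_right (hT.eigenvalues_antitone hn hij) (sq_nonneg _)
  exact le_of_mul_le_mul_right ((h a).trans h1) hx0

/-- Upper bound for an eigenvalue from a subspace, given by linear equations, on which the
quadratic form is small. -/
theorem eigenvalues_le_of_forall_orthogonal (j : Fin n) {c : ℝ} (u : Fin j → F)
    (h : ∀ x : F, (∀ i, inner ℝ (u i) x = 0) → inner ℝ x (T x) ≤ c * ‖x‖ ^ 2) :
    hT.eigenvalues hn j ≤ c := by
  let b := hT.eigenvectorBasis hn
  let v : Fin (j + 1) → F := fun i => b (i.castLE j.2)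
  have hv : Orthonormal ℝ v := b.orthonormal.comp _ (Fin.castLE_injective _)
  let f : (Fin (j + 1) → ℝ) →ₗ[ℝ] (Fin j → ℝ) :=
    LinearMap.pi fun i => (innerₛₗ ℝ (u i)).comp (Fintype.linearCombination ℝ v)
  have hker : LinearMap.ker f ≠ ⊥ := LinearMap.ker_ne_bot_of_finrank_lt (by simp)
  obtain ⟨a, ha, ha0⟩ := (Submodule.ne_bot_iff _).1 hker
  set x := ∑ i, a i • v i with hx
  have hxu : ∀ i, inner ℝ (u i) x = 0 := by
    intro i
    have := congrFun (LinearMap.mem_ker.1 ha) i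
    simpa [f, Fintype.linearCombination_apply] using this
  have hx0 : 0 < ‖x‖ ^ 2 := by
    have hxne : x ≠ 0 := fun h0 => ha0 (funext fun i =>
      Fintype.linearIndependent_iff.1 hv.linearIndependent a h0 i)
    have := norm_pos_iff.2 hxne
    positivity
  have hxb : ∀ i : Fin n, j < i → inner ℝ (b i) x = 0 := by
    intro i hi
    rw [hx, inner_sum]
    refine Finset.sum_eq_zero fun l _ => ?_
    rw [real_inner_smul_right, b.orthonormal.2, mul_zero]
    intro hil
    have := congrArg Fin.val hil
    simp only [Fin.val_castLE] at this
    have h3 : (j : ℕ) < i := hi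
    omega
  have h1 : hT.eigenvalues hn j * ‖x‖ ^ 2 ≤ inner ℝ x (T x) := by
    rw [inner_apply_self_eq_sum hT hn, ← b.sum_sq_inner_right, Finset.mul_sum]
    refine Finset.sum_le_sum fun i _ => ?_
    rcases lt_or_ge j i with hij | hij
    · rw [hxb i hij]; simp
    · exact mul_le_mul_of_nonneg_right (hT.eigenvalues_antitone hn hij) (sq_nonneg _)
  exact le_of_mul_le_mul_right (h1.trans (h x hxu)) hx0

/-- Eigenvalues of a perturbation of an operator of rank two. -/
theorem eigenvalues_rank_two_perturbation {u : Fin 2 → F} (hu : Orthonormal ℝ u) {α β δ : ℝ}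
    (hβ : 0 ≤ β) (hαβ : β ≤ α)
    (h : ∀ x, |inner ℝ x (T x) - (α * (inner ℝ (u 0) x) ^ 2 + β * (inner ℝ (u 1) x) ^ 2)| ≤
      δ * ‖x‖ ^ 2) (j : Fin n) :
    ((j : ℕ) = 0 → |hT.eigenvalues hn j - α| ≤ δ) ∧
    ((j : ℕ) = 1 → |hT.eigenvalues hn j - β| ≤ δ) ∧
    (2 ≤ (j : ℕ) → |hT.eigenvalues hn j| ≤ δ) := by
  have hbessel : ∀ x : F, (inner ℝ (u 0) x) ^ 2 + (inner ℝ (u 1) x) ^ 2 ≤ ‖x‖ ^ 2 := by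
    intro x
    have := hu.sum_inner_products_le x (s := Finset.univ)
    simpa [Fin.sum_univ_two] using this
  have hle : ∀ x, inner ℝ x (T x) ≤
      (α * (inner ℝ (u 0) x) ^ 2 + β * (inner ℝ (u 1) x) ^ 2) + δ * ‖x‖ ^ 2 := fun x => by
    linarith [(abs_le.1 (h x)).2]
  have hge : ∀ x, (α * (inner ℝ (u 0) x) ^ 2 + β * (inner ℝ (u 1) x) ^ 2) - δ * ‖x‖ ^ 2 ≤
      inner ℝ x (T x) := fun x => by
    linarith [(abs_le.1 (h x)).1]
  have h00 : inner ℝ (u 0) (u 0) = (1 : ℝ) := by rw [real_inner_self_eq_norm_sq, hu.1]; norm_num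
  have h11 : inner ℝ (u 1) (u 1) = (1 : ℝ) := by rw [real_inner_self_eq_norm_sq, hu.1]; norm_num
  have h01 : inner ℝ (u 0) (u 1) = (0 : ℝ) := hu.2 (by decide)
  have h10 : inner ℝ (u 1) (u 0) = (0 : ℝ) := hu.2 (by decide)
  obtain ⟨j, hj⟩ := j
  refine ⟨?_, ?_, ?_⟩
  · rintro (rfl : j = 0)
    have h1 : hT.eigenvalues hn ⟨0, hj⟩ ≤ α + δ := by
      refine eigenvalues_le_of_forall_orthogonal hT hn ⟨0, hj⟩ (fun i => i.elim0) fun x _ => ?_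
      have := hle x
      have := hbessel x
      nlinarith [sq_nonneg (inner ℝ (u 0) x), sq_nonneg (inner ℝ (u 1) x)]
    have h2 : α - δ ≤ hT.eigenvalues hn ⟨0, hj⟩ := by
      refine le_eigenvalues_of_orthonormal hT hn ⟨0, hj⟩ (fun _ => u 0)
        ⟨fun _ => hu.1 0, fun i k hik => absurd (Subsingleton.elim (α := Fin 1) i k) hik⟩ ?_
      intro a
      have hs : ∑ i : Fin (0 + 1), a i • u 0 = a 0 • u 0 := by simp
      change (α - δ) * ‖∑ i : Fin (0 + 1), a i • u 0‖ ^ 2 ≤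
        inner ℝ (∑ i : Fin (0 + 1), a i • u 0) (T (∑ i : Fin (0 + 1), a i • u 0))
      rw [hs]
      refine le_trans ?_ (hge _)
      rw [real_inner_smul_right, real_inner_smul_right, h00, h10, norm_smul, hu.1, mul_one,
        Real.norm_eq_abs, sq_abs]
      apply le_of_eq
      ring
    rw [abs_le]; constructor <;> linarith
  · rintro (rfl : j = 1)
    have h1 : hT.eigenvalues hn ⟨1, hj⟩ ≤ β + δ := by
      refine eigenvalues_le_of_forall_orthogonal hT hn ⟨1, hj⟩ (fun _ => u 0) fun x hx => ?_
      have hx0 := hx ⟨0, Nat.one_pos⟩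
      have h1 := hle x
      have h2 := hbessel x
      rw [hx0] at h1 h2
      nlinarith [sq_nonneg (inner ℝ (u 1) x)]
    have h2 : β - δ ≤ hT.eigenvalues hn ⟨1, hj⟩ := by
      refine le_eigenvalues_of_orthonormal hT hn ⟨1, hj⟩ u hu ?_
      intro a
      have hs : ∑ i : Fin (1 + 1), a i • u i = a 0 • u 0 + a 1 • u 1 := Fin.sum_univ_two _
      change (β - δ) * ‖∑ i : Fin (1 + 1), a i • u i‖ ^ 2 ≤
        inner ℝ (∑ i : Fin (1 + 1), a i • u i) (T (∑ i : Fin (1 + 1), a i • u i))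
      refine le_trans ?_ (hge _)
      rw [hs]
      have e0 : inner ℝ (u 0) (a 0 • u 0 + a 1 • u 1) = a 0 := by
        rw [inner_add_right, real_inner_smul_right, real_inner_smul_right, h00, h01]; ring
      have e1 : inner ℝ (u 1) (a 0 • u 0 + a 1 • u 1) = a 1 := by
        rw [inner_add_right, real_inner_smul_right, real_inner_smul_right, h10, h11]; ring
      have en : ‖a 0 • u 0 + a 1 • u 1‖ ^ 2 = a 0 ^ 2 + a 1 ^ 2 := by
        rw [← real_inner_self_eq_norm_sq, inner_add_left, real_inner_smul_left,
          real_inner_smul_left, e0, e1]; ring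
      rw [e0, e1, en]
      nlinarith [sq_nonneg (a 0)]
    rw [abs_le]; constructor <;> linarith
  · intro (hj2 : 2 ≤ j)
    have h1 : hT.eigenvalues hn ⟨j, hj⟩ ≤ δ := by
      -- Only two equations are needed; repeating `u 1` fills the remaining `j - 2` places.
      refine eigenvalues_le_of_forall_orthogonal hT hn ⟨j, hj⟩
        (fun i => if (i : ℕ) = 0 then u 0 else u 1) fun x hx => ?_
      have hx0 := hx ⟨0, by simp only; omega⟩
      have hx1 := hx ⟨1, by simp only; omega⟩
      simp only [if_true, one_ne_zero, if_false] at hx0 hx1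
      have h1 := hle x
      rw [hx0, hx1] at h1
      linarith
    -- The rank-two part is positive semidefinite, so the form is nowhere below `-δ * ‖x‖ ^ 2`;
    -- testing on the eigenvector suffices.
    have h2 : -δ ≤ hT.eigenvalues hn ⟨j, hj⟩ := by
      have := hge (hT.eigenvectorBasis hn ⟨j, hj⟩)
      rw [hT.apply_eigenvectorBasis] at this
      simp only [RCLike.ofReal_real_eq_id, id_eq, real_inner_smul_right,
        real_inner_self_eq_norm_sq, OrthonormalBasis.norm_eq_one] at this
      have h3 : 0 ≤ α * (inner ℝ (u 0) (hT.eigenvectorBasis hn ⟨j, hj⟩)) ^ 2 :=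
        mul_nonneg (hβ.trans hαβ) (sq_nonneg _)
      have h4 : 0 ≤ β * (inner ℝ (u 1) (hT.eigenvectorBasis hn ⟨j, hj⟩)) ^ 2 :=
        mul_nonneg hβ (sq_nonneg _)
      linarith
    rw [abs_le]; constructor <;> linarith

end Symmetric

/-! ### Trace moments and quadratic forms -/

section TraceNorm

variable {n : Type*} [Fintype n] [DecidableEq n] {A : Matrix n n ℝ}

theorem trace_pow_eq_sum_eigenvalues (hA : A.IsHermitian) (N : ℕ) :
    (A ^ N).trace = ∑ i, hA.eigenvalues i ^ N := by
  conv_lhs => rw [hA.spectral_theorem]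
  rw [← map_pow, Unitary.conjStarAlgAut_apply, Matrix.trace_mul_cycle, Unitary.coe_star_mul_self,
    one_mul, Matrix.diagonal_pow, Matrix.trace_diagonal]
  simp

theorem trace_pow_nonneg (hA : A.IsHermitian) (m : ℕ) : 0 ≤ (A ^ (2 * m)).trace := by
  rw [trace_pow_eq_sum_eigenvalues hA]
  exact Finset.sum_nonneg fun i _ => (even_two_mul m).pow_nonneg _

/-- A bound on a trace moment bounds the quadratic form. -/
theorem abs_inner_le_of_trace_pow_le (hA : A.IsHermitian) {m : ℕ} (hm : 0 < m) {t : ℝ}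
    (ht : 0 ≤ t) (h : (A ^ (2 * m)).trace ≤ t ^ (2 * m)) (x : EuclideanSpace ℝ n) :
    |inner ℝ x (Matrix.toEuclideanLin A x)| ≤ t * ‖x‖ ^ 2 := by
  have hT := Matrix.isSymmetric_toEuclideanLin_iff.mpr hA
  have hev : ∀ i, |hA.eigenvalues i| ≤ t := by
    intro i
    rw [trace_pow_eq_sum_eigenvalues hA] at h
    have h1 : hA.eigenvalues i ^ (2 * m) ≤ t ^ (2 * m) :=
      (Finset.single_le_sum (f := fun i => hA.eigenvalues i ^ (2 * m))
        (fun j _ => (even_two_mul m).pow_nonneg _) (Finset.mem_univ i)).trans h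
    rw [← (even_two_mul m).pow_abs] at h1
    exact le_of_pow_le_pow_left₀ (by omega) ht h1
  have hev' : ∀ i, |hT.eigenvalues finrank_euclideanSpace i| ≤ t := by
    intro i
    have := hev (Fintype.equivOfCardEq (Fintype.card_fin _) i)
    rwa [Matrix.IsHermitian.eigenvalues, Equiv.symm_apply_apply] at this
  rw [inner_apply_self_eq_sum hT finrank_euclideanSpace,
    ← (hT.eigenvectorBasis finrank_euclideanSpace).sum_sq_inner_right, Finset.mul_sum]
  refine (Finset.abs_sum_le_sum_abs _ _).trans (Finset.sum_le_sum fun i _ => ?_)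
  rw [abs_mul, abs_sq]
  exact mul_le_mul_of_nonneg_right (hev' i) (sq_nonneg _)

end TraceNorm

/-! ### The noise of the signed Erdős–Rényi model -/

section Noise

variable {n : ℕ}

/-- The expectation of the entry attached to the pair `e`. -/
noncomputable def meanEntry (P S : Matrix (Fin n) (Fin n) I) (e : Pairs n) : ℝ :=
  P e.1.1 e.1.2 * (1 - 2 * S e.1.1 e.1.2)

/-- Half of the centred entry attached to the pair `e`; it lies in `[-1, 1]`. -/
noncomputable def noiseEntry (P S : Matrix (Fin n) (Fin n) I) (e : Pairs n) (b : Bool × Bool) : ℝ :=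
  (signedEntry b - meanEntry P S e) / 2

theorem integral_pair_bernoulli (x y : I) (f : Bool × Bool → ℝ) :
    ∫ b, f b ∂(bernoulliMeasure true false x).prod (bernoulliMeasure true false y) =
      x * (y * f (true, true) + (1 - y) * f (true, false)) +
        (1 - x) * (y * f (false, true) + (1 - y) * f (false, false)) := by
  rw [integral_prod _ Integrable.of_finite]
  simp only [integral_bernoulliMeasure, smul_eq_mul]

theorem abs_meanEntry_le (P S : Matrix (Fin n) (Fin n) I) (e : Pairs n) :
    |meanEntry P S e| ≤ 1 := by
  rw [meanEntry, abs_mul]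
  have h1 := (P e.1.1 e.1.2).2
  have h2 := (S e.1.1 e.1.2).2
  refine mul_le_one₀ (abs_le.2 ⟨by linarith [h1.1], h1.2⟩) (abs_nonneg _)
    (abs_le.2 ⟨by linarith [h2.2], by linarith [h2.1]⟩)

theorem abs_noiseEntry_le (P S : Matrix (Fin n) (Fin n) I) (e : Pairs n) (b : Bool × Bool) :
    |noiseEntry P S e b| ≤ 1 := by
  have h1 := abs_le.1 (abs_meanEntry_le P S e)
  have h2 : |signedEntry b| ≤ 1 := by
    obtain ⟨b₁, b₂⟩ := b
    cases b₁ <;> cases b₂ <;> simp [signedEntry]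
  rw [abs_le] at h2
  rw [noiseEntry, abs_le]
  constructor <;> linarith [h1.1, h1.2, h2.1, h2.2]

theorem integral_noiseEntry (P S : Matrix (Fin n) (Fin n) I) (e : Pairs n) :
    ∫ b, noiseEntry P S e b ∂(bernoulliMeasure true false (P e.1.1 e.1.2)).prod
      (bernoulliMeasure true false (S e.1.1 e.1.2)) = 0 := by
  rw [integral_pair_bernoulli]
  simp only [noiseEntry, signedEntry, meanEntry, if_true, Bool.false_eq_true, if_false]
  ring

/-- Halving keeps the entry in `[-1, 1]`, so higher moments are dominated by the second, which is a
quarter of the variance of a variable with second moment `P`. -/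
theorem abs_integral_noiseEntry_pow_le (P S : Matrix (Fin n) (Fin n) I) (e : Pairs n) {k : ℕ}
    (hk : 2 ≤ k) :
    |∫ b, noiseEntry P S e b ^ k ∂(bernoulliMeasure true false (P e.1.1 e.1.2)).prod
      (bernoulliMeasure true false (S e.1.1 e.1.2))| ≤ P e.1.1 e.1.2 := by
  refine abs_integral_le_integral_abs.trans ?_
  calc _ ≤ ∫ b, noiseEntry P S e b ^ 2 ∂(bernoulliMeasure true false (P e.1.1 e.1.2)).prod
        (bernoulliMeasure true false (S e.1.1 e.1.2)) := by
        refine integral_mono Integrable.of_finite Integrable.of_finite fun b => ?_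
        change |noiseEntry P S e b ^ k| ≤ noiseEntry P S e b ^ 2
        rw [abs_pow, ← sq_abs (noiseEntry P S e b)]
        exact pow_le_pow_of_le_one (abs_nonneg _) (abs_noiseEntry_le P S e b) hk
    _ ≤ _ := by
        rw [integral_pair_bernoulli]
        simp only [noiseEntry, signedEntry, meanEntry, if_true, Bool.false_eq_true, if_false]
        have h1 : (0 : ℝ) ≤ P e.1.1 e.1.2 := (P e.1.1 e.1.2).2.1
        generalize (P e.1.1 e.1.2 : ℝ) = x at h1 ⊢
        generalize (S e.1.1 e.1.2 : ℝ) = y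
        have : x * (y * ((-1 - x * (1 - 2 * y)) / 2) ^ 2 +
            (1 - y) * ((1 - x * (1 - 2 * y)) / 2) ^ 2) +
            (1 - x) * (y * ((0 - x * (1 - 2 * y)) / 2) ^ 2 +
              (1 - y) * ((0 - x * (1 - 2 * y)) / 2) ^ 2) =
            (x - (x * (1 - 2 * y)) ^ 2) / 4 := by ring
        rw [this]
        nlinarith [sq_nonneg (x * (1 - 2 * y))]

theorem integral_trace_pow_noise_le (P S : Matrix (Fin n) (Fin n) I) {p : ℝ} (hp0 : 0 ≤ p)
    (hp1 : p ≤ 1) (hp : ∀ e : Pairs n, (P e.1.1 e.1.2 : ℝ) ≤ p) {r m : ℕ} (hm : 0 < m)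
    (hr : n * p + (2 * m : ℕ) ≤ r) :
    ∫ ω, (pairMatrix (noiseEntry P S) ω ^ (2 * m)).trace ∂outcomeMeasure P S ≤
      n * (25 ^ r * (2 * (2 * m) ^ m * Real.exp (288 * m))) := by
  have h1 := integral_trace_pow_pairMatrix_le_refMatrix
    (fun e : Pairs n => (bernoulliMeasure true false (P e.1.1 e.1.2)).prod
      (bernoulliMeasure true false (S e.1.1 e.1.2))) (noiseEntry P S) hp0 hp1
    (integral_noiseEntry P S)
    (fun e k hk => (abs_integral_noiseEntry_pow_le P S e hk).trans (hp e))
    (by omega : 0 < 2 * m) hr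
  have h2 := integral_trace_pow_refMatrix_le r hm
  have hr0 : (0 : ℝ) < r := by
    have h3 : (0 : ℝ) < (2 * m : ℕ) := by positivity
    have h4 : 0 ≤ n * p := by positivity
    linarith
  refine le_of_mul_le_mul_left ?_ hr0
  calc _ ≤ _ := h1
    _ ≤ n * (r * (25 ^ r * (2 * (2 * m) ^ m * Real.exp (288 * m)))) :=
        mul_le_mul_of_nonneg_left h2 (Nat.cast_nonneg n)
    _ = _ := by ring

/-- With high probability the trace moment of the noise is small. -/
theorem measureReal_trace_pow_noise_le (P S : Matrix (Fin n) (Fin n) I) {p : ℝ} (hp0 : 0 ≤ p)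
    (hp1 : p ≤ 1) (hp : ∀ e : Pairs n, (P e.1.1 e.1.2 : ℝ) ≤ p) {G m : ℕ} (hm : 0 < m)
    (hG : n * p ≤ G * m) {t : ℝ}
    (ht : t ^ 2 = Real.exp 4 * (4 * 25 ^ (G + 2) * Real.exp 288 * m)) :
    (outcomeMeasure P S).real
      {ω | t ^ (2 * m) ≤ (pairMatrix (noiseEntry P S) ω ^ (2 * m)).trace} ≤
      n * Real.exp (-(4 * m)) := by
  -- The reference size `r = (G + 2) * m` is proportional to `m`, which turns `25 ^ r` into a
  -- constant to the power `m`.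
  have h1 := integral_trace_pow_noise_le P S hp0 hp1 hp (r := G * m + 2 * m) hm (by
    push_cast; linarith)
  have h2 := (mul_meas_ge_le_integral_of_nonneg (μ := outcomeMeasure P S)
    (f := fun ω => (pairMatrix (noiseEntry P S) ω ^ (2 * m)).trace)
    (ae_of_all _ fun ω => trace_pow_nonneg (isHermitian_pairMatrix _ ω) m)
    Integrable.of_finite (t ^ (2 * m))).trans h1
  have hm' : (0 : ℝ) < m := by exact_mod_cast hm
  -- The choice of `t` makes the threshold `exp (4m)` times a bound `L` for the moment divided by
  -- `n`, so Markov's inequality leaves `n * exp (-4m)`.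
  have ht2 : t ^ (2 * m) = Real.exp (4 * m) * (4 ^ m * 25 ^ (G * m + 2 * m) *
      Real.exp (288 * m) * m ^ m) := by
    rw [pow_mul, ht, mul_pow, mul_pow, mul_pow, mul_pow, ← Real.exp_nat_mul, ← Real.exp_nat_mul,
      ← pow_mul, add_mul, mul_comm (m : ℝ) 4, mul_comm (m : ℝ) 288]
  set L : ℝ := 4 ^ m * 25 ^ (G * m + 2 * m) * Real.exp (288 * m) * m ^ m with hL
  have hLpos : 0 < L := by positivity
  have h3 : (25 : ℝ) ^ (G * m + 2 * m) * (2 * (2 * m) ^ m * Real.exp (288 * m)) ≤ L := by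
    have h4 : (2 : ℝ) * 2 ^ m ≤ 4 ^ m := by
      have : (2 : ℝ) ≤ 2 ^ m := by
        calc (2 : ℝ) = 2 ^ 1 := by norm_num
          _ ≤ 2 ^ m := pow_le_pow_right₀ (by norm_num) hm
      calc (2 : ℝ) * 2 ^ m ≤ 2 ^ m * 2 ^ m := by gcongr
        _ = 4 ^ m := by rw [← mul_pow]; norm_num
    calc _ = (2 * 2 ^ m) * (25 ^ (G * m + 2 * m) * Real.exp (288 * m) * (m : ℝ) ^ m) := by
          rw [mul_pow]; ring
      _ ≤ 4 ^ m * (25 ^ (G * m + 2 * m) * Real.exp (288 * m) * (m : ℝ) ^ m) := by gcongr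
      _ = L := by rw [hL]; ring
  set μb := (outcomeMeasure P S).real
    {ω | t ^ (2 * m) ≤ (pairMatrix (noiseEntry P S) ω ^ (2 * m)).trace}
  rw [ht2] at h2
  have h5 : Real.exp (4 * m) * μb ≤ n := by
    refine le_of_mul_le_mul_right ?_ hLpos
    calc Real.exp (4 * m) * μb * L = Real.exp (4 * m) * L * μb := by ring
      _ ≤ _ := h2
      _ ≤ n * L := mul_le_mul_of_nonneg_left h3 (Nat.cast_nonneg n)
  rw [Real.exp_neg, ← div_eq_mul_inv, le_div_iff₀ (Real.exp_pos _)]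
  linarith

theorem signedAdjacency_eq (P S : Matrix (Fin n) (Fin n) I) (ω : Outcome n) (i j : Fin n) :
    signedAdjacency ω i j = pairMatrix (fun e _ => meanEntry P S e) ω i j +
      2 * pairMatrix (noiseEntry P S) ω i j := by
  have h : signedAdjacency ω i j = pairMatrix (fun _ => signedEntry) ω i j := rfl
  rw [h]
  by_cases hij : i = j
  · subst hij; simp [pairMatrix_apply_self]
  · simp only [pairMatrix_apply _ _ hij, noiseEntry]
    ring

end Noise

/-! ### The expectation in the two-community model -/

section Block

variable {k : ℕ}

/-- The sign of the community of a node. -/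
def community (k : ℕ) (i : Fin (2 * k)) : ℝ := if (i : ℕ) < k then 1 else -1

theorem community_mul_self (i : Fin (2 * k)) : community k i * community k i = 1 := by
  unfold community; split_ifs <;> norm_num

theorem sum_community : ∑ i, community k i = 0 := by
  have h : ∑ i : Fin (2 * k), community k i =
      ∑ i ∈ Finset.range (2 * k), if i < k then (1 : ℝ) else -1 :=
    Fin.sum_univ_eq_sum_range (fun i => if i < k then (1 : ℝ) else -1) (2 * k)
  rw [h, two_mul, Finset.sum_range_add]
  simp [Finset.sum_ite, Finset.filter_true_of_mem]

/-- Across communities the mean is `q * (1 - 2 * (1 - s)) = -(1 - 2s) * q`. This sign flip attaches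
`p + q` to the community vector and `p - q` to the constant vector. -/
theorem blockMean_apply (p q s : I) (ω : Outcome (2 * k)) (i j : Fin (2 * k)) :
    pairMatrix (fun e _ => meanEntry (blockMatrix k p q)
      (blockMatrix k s (unitInterval.symm s)) e) ω i j =
      (1 - 2 * s) * (p + q) / 2 * (community k i * community k j) +
        (1 - 2 * s) * (p - q) / 2 - (1 - 2 * s) * p * if i = j then 1 else 0 := by
  by_cases hij : i = j
  · subst hij
    rw [pairMatrix_apply_self, community_mul_self, if_pos rfl]
    ring
  · rw [pairMatrix_apply _ _ hij, if_neg hij]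
    have key : ∀ a b : Fin (2 * k), a ≠ b → (blockMatrix k p q a b : ℝ) *
        (1 - 2 * blockMatrix k s (unitInterval.symm s) a b) =
        (1 - 2 * s) * (p + q) / 2 * (community k a * community k b) +
          (1 - 2 * s) * (p - q) / 2 := by
      intro a b hab
      simp only [blockMatrix, Matrix.of_apply, if_neg hab, community]
      by_cases ha : (a : ℕ) < k <;> by_cases hb : (b : ℕ) < k <;>
        simp [ha, hb, unitInterval.coe_symm_eq] <;> ring
    have h2 := key _ _ (ne_of_lt (pairOf i j hij).2)
    simp only [meanEntry]
    rw [h2]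
    rcases Sym2.eq_iff.1 (sym2_pairOf i j hij) with ⟨h3, h4⟩ | ⟨h3, h4⟩
    · rw [h3, h4]; ring
    · rw [h3, h4]; ring

theorem inner_toEuclideanLin_eq_sum {n : ℕ} (A : Matrix (Fin n) (Fin n) ℝ)
    (x : EuclideanSpace ℝ (Fin n)) :
    inner ℝ x (Matrix.toEuclideanLin A x) = ∑ i, ∑ j, x i * A i j * x j := by
  rw [← Matrix.coe_toEuclideanCLM_eq_toEuclideanLin]
  change inner ℝ x (Matrix.toEuclideanCLM (𝕜 := ℝ) A x) = _
  rw [Matrix.inner_toEuclideanCLM]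
  simp only [dotProduct, Matrix.mulVec, Finset.mul_sum]
  exact Finset.sum_congr rfl fun i _ => Finset.sum_congr rfl fun j _ => by ring

/-- The normalized community vector and the normalized constant vector. -/
noncomputable def blockVector (k : ℕ) (l : Fin 2) : EuclideanSpace ℝ (Fin (2 * k)) :=
  WithLp.toLp 2 fun i => (√(2 * k))⁻¹ * if l = 0 then community k i else 1

theorem inner_blockVector (l : Fin 2) (x : EuclideanSpace ℝ (Fin (2 * k))) :
    inner ℝ (blockVector k l) x =
      (√(2 * k))⁻¹ * ∑ i, (if l = 0 then community k i else 1) * x i := by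
  rw [PiLp.inner_apply, Finset.mul_sum]
  refine Finset.sum_congr rfl fun i _ => ?_
  simp only [blockVector, RCLike.inner_apply, conj_trivial]
  ring

theorem inner_blockVector_sq (hk : 0 < k) (l : Fin 2) (x : EuclideanSpace ℝ (Fin (2 * k))) :
    inner ℝ (blockVector k l) x ^ 2 * (2 * k) =
      (∑ i, (if l = 0 then community k i else 1) * x i) ^ 2 := by
  have hk' : (0 : ℝ) < 2 * k := by positivity
  rw [inner_blockVector, mul_pow, inv_pow, Real.sq_sqrt hk'.le]
  field_simp

theorem orthonormal_blockVector (hk : 0 < k) : Orthonormal ℝ (blockVector k) := by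
  have hk' : (0 : ℝ) < 2 * k := by positivity
  have hs : (√(2 * k : ℝ))⁻¹ * (√(2 * k))⁻¹ * (2 * k) = 1 := by
    rw [← mul_inv, Real.mul_self_sqrt hk'.le, inv_mul_cancel₀ hk'.ne']
  rw [orthonormal_iff_ite]
  intro l l'
  rw [inner_blockVector]
  simp only [blockVector]
  have h1 : ∑ i : Fin (2 * k), community k i * ((√(2 * k : ℝ))⁻¹ * community k i) =
      (√(2 * k))⁻¹ * (2 * k) := by
    simp only [mul_left_comm (community k _), community_mul_self]
    simp [mul_comm]
  have h2 : ∑ i : Fin (2 * k), (√(2 * k : ℝ))⁻¹ * community k i = 0 := by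
    rw [← Finset.mul_sum, sum_community, mul_zero]
  fin_cases l <;> fin_cases l'
  · simp only [Fin.zero_eta, if_true]
    rw [h1, ← mul_assoc, hs]
  · simp only [Fin.zero_eta, Fin.mk_one, if_true, one_ne_zero, if_false, mul_one, zero_ne_one]
    rw [← Finset.sum_mul, sum_community]; simp
  · simp only [Fin.zero_eta, Fin.mk_one, if_true, one_ne_zero, if_false, one_mul]
    rw [h2, mul_zero]
  · simp only [Fin.mk_one, one_ne_zero, if_false, if_true, mul_one, one_mul, Finset.sum_const,
      Finset.card_univ, Fintype.card_fin, nsmul_eq_mul]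
    push_cast
    linarith

theorem inner_signedAdjacency (hk : 0 < k) (p q s : I) (ω : Outcome (2 * k))
    (x : EuclideanSpace ℝ (Fin (2 * k))) :
    inner ℝ x (Matrix.toEuclideanLin (signedAdjacency ω) x) -
      ((1 - 2 * s) * (p + q) * k * inner ℝ (blockVector k 0) x ^ 2 +
        (1 - 2 * s) * (p - q) * k * inner ℝ (blockVector k 1) x ^ 2) =
      2 * inner ℝ x (Matrix.toEuclideanLin (pairMatrix (noiseEntry (blockMatrix k p q)
        (blockMatrix k s (unitInterval.symm s))) ω) x) - (1 - 2 * s) * p * ‖x‖ ^ 2 := by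
  have h0 := inner_blockVector_sq hk 0 x
  have h1 := inner_blockVector_sq hk 1 x
  simp only [if_true, one_ne_zero, if_false, one_mul] at h0 h1
  have e0 : ∑ i, ∑ j, x i * (community k i * community k j) * x j =
      (∑ i, community k i * x i) ^ 2 := by
    rw [sq, Finset.sum_mul_sum]
    exact Finset.sum_congr rfl fun i _ => Finset.sum_congr rfl fun j _ => by ring
  have e1 : ∑ i, ∑ j, x i * x j = (∑ i, x i) ^ 2 := by
    rw [sq, Finset.sum_mul_sum]
  have e2 : ∑ i, ∑ j, x i * (if i = j then 1 else 0) * x j = ‖x‖ ^ 2 := by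
    rw [EuclideanSpace.real_norm_sq_eq]
    refine Finset.sum_congr rfl fun i _ => ?_
    simp [sq]
  have main : inner ℝ x (Matrix.toEuclideanLin (signedAdjacency ω) x) =
      (1 - 2 * s) * (p + q) / 2 * (∑ i, community k i * x i) ^ 2 +
        (1 - 2 * s) * (p - q) / 2 * (∑ i, x i) ^ 2 - (1 - 2 * s) * p * ‖x‖ ^ 2 +
      2 * inner ℝ x (Matrix.toEuclideanLin (pairMatrix (noiseEntry (blockMatrix k p q)
        (blockMatrix k s (unitInterval.symm s))) ω) x) := by
    rw [← e0, ← e1, ← e2]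
    simp only [inner_toEuclideanLin_eq_sum, Finset.mul_sum, ← Finset.sum_add_distrib,
      ← Finset.sum_sub_distrib]
    refine Finset.sum_congr rfl fun i _ => Finset.sum_congr rfl fun j _ => ?_
    rw [signedAdjacency_eq (blockMatrix k p q) (blockMatrix k s (unitInterval.symm s)),
      blockMean_apply]
    ring
  rw [main, ← h0, ← h1]
  ring

theorem isHermitian_signedAdjacency {n : ℕ} (ω : Outcome n) : (signedAdjacency ω).IsHermitian :=
  isHermitian_pairMatrix (fun _ => signedEntry) ω

/-- Deterministic control of the spectrum by a trace moment of the noise. -/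
theorem ascEigenvalue_signedAdjacency (hk : 2 ≤ k) {p q s : I} (hqp : (q : ℝ) ≤ p)
    (hs : (s : ℝ) ≤ 1 / 2) {m : ℕ} (hm : 0 < m) {t : ℝ} (ht : 0 ≤ t) {ω : Outcome (2 * k)}
    (h : (pairMatrix (noiseEntry (blockMatrix k p q)
      (blockMatrix k s (unitInterval.symm s))) ω ^ (2 * m)).trace ≤ t ^ (2 * m)) :
    |ascEigenvalue (isHermitian_signedAdjacency ω) (2 * k) - (1 - 2 * s) * (p + q) * k| ≤
        2 * t + p ∧
      |ascEigenvalue (isHermitian_signedAdjacency ω) (2 * k - 1) - (1 - 2 * s) * (p - q) * k| ≤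
        2 * t + p ∧
      ∀ ℓ, 1 ≤ ℓ → ℓ < 2 * k - 1 →
        |ascEigenvalue (isHermitian_signedAdjacency ω) ℓ| ≤ 2 * t + p := by
  have hs0 : (0 : ℝ) ≤ s := s.2.1
  have hp0 : (0 : ℝ) ≤ p := p.2.1
  have hq0 : (0 : ℝ) ≤ q := q.2.1
  have hs1 : 0 ≤ 1 - 2 * (s : ℝ) := by linarith
  have hT := Matrix.isSymmetric_toEuclideanLin_iff.mpr (isHermitian_signedAdjacency ω)
  have key := eigenvalues_rank_two_perturbation hT finrank_euclideanSpace
    (orthonormal_blockVector (k := k) (by omega))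
    (α := (1 - 2 * s) * (p + q) * k) (β := (1 - 2 * s) * (p - q) * k) (δ := 2 * t + p)
    (by have := sub_nonneg.2 hqp; positivity)
    (by gcongr; linarith) (fun x => by
      rw [inner_signedAdjacency (by omega)]
      have h1 := abs_le.1 (abs_inner_le_of_trace_pow_le (isHermitian_pairMatrix _ ω) hm ht h x)
      -- The missing diagonal of the mean contributes at most `p` to the error.
      have h2 : (1 - 2 * s) * p * ‖x‖ ^ 2 ≤ p * ‖x‖ ^ 2 := by
        gcongr
        nlinarith
      have h3 : 0 ≤ (1 - 2 * s) * p * ‖x‖ ^ 2 := by positivity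
      have h4 : 0 ≤ p * ‖x‖ ^ 2 := by positivity
      rw [abs_le]
      constructor <;> linarith [h1.1, h1.2])
  refine ⟨?_, ?_, fun ℓ h1 h2 => ?_⟩
  -- In the decreasing list, ascending indices `2k`, `2k - 1` and `ℓ < 2k - 1` sit at positions `0`,
  -- `1` and at least `2`.
  · rw [ascEigenvalue, dif_pos (by omega)]
    exact (key _).1 (by simp)
  · rw [ascEigenvalue, dif_pos (by omega)]
    exact (key _).2.1 (by simp only; omega)
  · rw [ascEigenvalue, dif_pos (by omega)]
    exact (key _).2.2 (by simp only; omega)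

end Block

end SignedSBM

/-! ### Choice of parameters and conclusion -/

theorem corollary4p8 (γ₁ γ₂ : ℝ) (s : unitInterval)
    (hγ₂ : 0 < γ₂) (hγ : γ₂ < γ₁) (hs₀ : 0 < (s : ℝ)) (hs : (s : ℝ) < 1 / 2) :
    ∃ C : ℝ, 0 < C ∧ ∃ ε : ℕ → ℝ, Tendsto ε atTop (𝓝 0) ∧
      ∀ k : ℕ, 2 ≤ k → ∀ p q : unitInterval,
        (p : ℝ) = γ₁ * Real.log k / k → (q : ℝ) = γ₂ * Real.log k / k →
        1 - (k : ℝ) ^ (-2 : ℤ) ≤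
          (SignedSBM.signedBlock k p q s).real
            {A | ∃ hA : A.IsHermitian,
              |SignedSBM.ascEigenvalue hA (2 * k)
                  - (1 - 2 * (s : ℝ)) * (γ₁ + γ₂) * Real.log k|
                ≤ C * √(Real.log k) + ε k ∧
              |SignedSBM.ascEigenvalue hA (2 * k - 1)
                  - (1 - 2 * (s : ℝ)) * (γ₁ - γ₂) * Real.log k|
                ≤ C * √(Real.log k) + ε k ∧
              ∀ ℓ : ℕ, 1 ≤ ℓ → ℓ < 2 * k - 1 →
                |SignedSBM.ascEigenvalue hA ℓ| ≤ C * √(Real.log k) + ε k} := by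
  set G : ℕ := ⌈2 * γ₁⌉₊ with hG
  set B : ℝ := Real.exp 4 * (4 * 25 ^ (G + 2) * Real.exp 288) with hB
  have hB0 : 0 < B := by positivity
  -- The error is `2 * t + p` with `t = √(B * m)` and `m ≤ 3 * log k`. The sequence `ε` is `p`
  -- itself.
  refine ⟨2 * √(3 * B), by positivity, fun k => γ₁ * (Real.log k / k), ?_, ?_⟩
  · have h1 : Tendsto (fun x : ℝ => Real.log x / x) atTop (𝓝 0) := by
      simpa using Real.tendsto_pow_log_div_mul_add_atTop 1 0 1 one_ne_zero
    simpa using (h1.comp tendsto_natCast_atTop_atTop).const_mul γ₁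
  intro k hk p q hp hq
  have hk0 : (0 : ℝ) < k := by positivity
  have hk2 : (2 : ℝ) ≤ k := by exact_mod_cast hk
  -- This lower bound absorbs the rounding in `m < log k + 1 ≤ 3 * log k`.
  have hlog : 1 / 2 ≤ Real.log k := by
    have h1 := Real.log_le_log (by norm_num) hk2
    linarith [Real.log_two_gt_d9]
  set m : ℕ := ⌈Real.log k⌉₊ with hm
  have hm0 : 0 < m := Nat.ceil_pos.2 (by linarith)
  have hlm : Real.log k ≤ m := Nat.le_ceil _
  have hml : (m : ℝ) ≤ 3 * Real.log k := by
    have := Nat.ceil_lt_add_one (a := Real.log k) (by linarith)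
    linarith
  have hpk : (p : ℝ) * k = γ₁ * Real.log k := by rw [hp]; field_simp
  have hqk : (q : ℝ) * k = γ₂ * Real.log k := by rw [hq]; field_simp
  have hqp : (q : ℝ) ≤ p := by rw [hp, hq]; gcongr
  set t : ℝ := √(B * m) with ht
  have ht2 : t ^ 2 = Real.exp 4 * (4 * 25 ^ (G + 2) * Real.exp 288 * m) := by
    rw [ht, Real.sq_sqrt (by positivity), hB]; ring
  have hbad := SignedSBM.measureReal_trace_pow_noise_le (SignedSBM.blockMatrix k p q)
    (SignedSBM.blockMatrix k s (unitInterval.symm s)) p.2.1 p.2.2 (by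
      intro e
      simp only [SignedSBM.blockMatrix, Matrix.of_apply]
      split_ifs
      · exact p.2.1
      · exact le_rfl
      · exact hqp) (G := G) hm0 (by
      have h1 : 2 * γ₁ ≤ G := Nat.le_ceil _
      calc ((2 * k : ℕ) : ℝ) * p = 2 * γ₁ * Real.log k := by push_cast; linarith
        _ ≤ G * m := by gcongr) ht2
  set ν := SignedSBM.outcomeMeasure (SignedSBM.blockMatrix k p q)
    (SignedSBM.blockMatrix k s (unitInterval.symm s)) with hν
  set bad : Set (SignedSBM.Outcome (2 * k)) := {ω | t ^ (2 * m) ≤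
    (SignedSBM.pairMatrix (SignedSBM.noiseEntry (SignedSBM.blockMatrix k p q)
      (SignedSBM.blockMatrix k s (unitInterval.symm s))) ω ^ (2 * m)).trace} with hbaddef
  have hprob : 1 - (k : ℝ) ^ (-2 : ℤ) ≤ ν.real badᶜ := by
    rw [measureReal_compl (Set.toFinite bad).measurableSet, probReal_univ]
    have h1 : Real.exp (-(4 * m)) ≤ ((k : ℝ) ^ 4)⁻¹ := by
      rw [Real.exp_neg]
      gcongr
      calc (k : ℝ) ^ 4 = Real.exp (4 * Real.log k) := by
            rw [mul_comm, Real.exp_mul, Real.exp_log hk0]; norm_cast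
        _ ≤ _ := by gcongr
    -- Here `2k / k ^ 4 ≤ k ^ (-2)` amounts to `2 ≤ k`.
    have h2 : ((2 * k : ℕ) : ℝ) * ((k : ℝ) ^ 4)⁻¹ ≤ (k : ℝ) ^ (-2 : ℤ) := by
      rw [zpow_neg, ← div_eq_mul_inv, div_le_iff₀ (by positivity), inv_mul_eq_div,
        le_div_iff₀ (by positivity)]
      norm_cast
      nlinarith [Nat.mul_le_mul_left (k ^ 3) hk]
    have h3 : ((2 * k : ℕ) : ℝ) * Real.exp (-(4 * m)) ≤ ((2 * k : ℕ) : ℝ) * ((k : ℝ) ^ 4)⁻¹ :=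
      mul_le_mul_of_nonneg_left h1 (Nat.cast_nonneg _)
    linarith
  have hbound : 2 * t + p ≤ 2 * √(3 * B) * √(Real.log k) + γ₁ * (Real.log k / k) := by
    have h1 : t ≤ √(3 * B) * √(Real.log k) := by
      rw [ht, ← Real.sqrt_mul (by positivity)]
      apply Real.sqrt_le_sqrt
      nlinarith
    rw [hp, mul_div_assoc]
    linarith
  refine hprob.trans ?_
  refine ENNReal.toReal_mono (measure_ne_top _ _) ?_
  -- The inequality `Measure.le_map_apply` holds for arbitrary sets, so measurability of the
  -- spectral event is not required.
  refine le_trans (measure_mono ?_)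
    (Measure.le_map_apply SignedSBM.measurable_signedAdjacency.aemeasurable _)
  intro ω hω
  have hω' := hω
  rw [hbaddef, Set.mem_compl_iff, Set.mem_ofPred_eq, not_le] at hω'
  obtain ⟨h1, h2, h3⟩ := SignedSBM.ascEigenvalue_signedAdjacency hk hqp hs.le hm0
    (Real.sqrt_nonneg _) hω'.le
  have e1 : (1 - 2 * (s : ℝ)) * (p + q) * k = (1 - 2 * (s : ℝ)) * (γ₁ + γ₂) * Real.log k := by
    linear_combination (1 - 2 * (s : ℝ)) * (hpk + hqk)
  have e2 : (1 - 2 * (s : ℝ)) * (p - q) * k = (1 - 2 * (s : ℝ)) * (γ₁ - γ₂) * Real.log k := by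
    linear_combination (1 - 2 * (s : ℝ)) * (hpk - hqk)
  rw [e1] at h1
  rw [e2] at h2
  exact ⟨SignedSBM.isHermitian_signedAdjacency ω, h1.trans hbound, h2.trans hbound,
    fun ℓ hl1 hl2 => (h3 ℓ hl1 hl2).trans hbound⟩
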